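/- **Setting.** *Matchbox manifolds.* Let $\mathfrak M$ be a compact, connected, metrizable space and $\mathfrak X$ a separable, metrizable, totally disconnected space. A *foliation chart* of $\mathfrak M$ is a homeomorphism $\varphi\colon \overline U\to[-1,1]^n\times\mathfrak X_\varphi$, with $\mathfrak X_\varphi\subset\mathfrak X$ compact and clopen, which extends to a homeomorphism from an open set $\widehat U\supset\overline U$ onto $(-2,2)^n\times\mathfrak X_\varphi$; put $U=\varphi^{-1}((-1,1)^n\times\mathfrak X_\varphi)$, let $\pi_\varphi$ be the projection of the chart to $\mathfrak X_\varphi$, and let $\tau_\varphi(w)=\varphi^{-1}(0,w)$. The sets $\pi_\varphi^{-1}(w)$ are the *plaques*. $\mathfrak M$ is a *matchbox manifold* of dimension $n$ with transverse model $\mathfrak X$ if each $x\in\mathfrak M$ has a foliation chart $\varphi_x$ with $\varphi_x(x)\in\{0\}\times\mathfrak X_{\varphi_x}$, and the coordinate changes along plaques between these charts are $C^\infty$ and depend continuously on the point in the $C^\infty$ topology. Its *leaves* are the connected components of the topology with basis the sets $\varphi_x^{-1}(V\times\{w\})$, $V\subset(-1,1)^n$ open; $\mathfrak M$ is *minimal*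 if every leaf is dense. A *regular covering* of $\mathfrak M$ is a finite family of foliation charts $\varphi_1,\dots,\varphi_\nu$ of its smooth structure such that the $U_i$ cover $\mathfrak M$, the $\mathfrak X_i$ form a partition $\mathfrak X=\mathfrak X_1\sqcup\dots\sqcup\mathfrak X_\nu$ into clopen sets, each $\mathfrak X_{i,j}=\pi_i(U_i\cap U_j)$ is clopen, and inside $U_i\cap U_j$ each plaque of $\varphi_i$ meets at most one plaque of $\varphi_j$. It defines homeomorphisms $h_{i,j}\colon\mathfrak X_{i,j}\to\mathfrak X_{j,i}$ by $h_{i,j}(\pi_i(z))=\pi_j(z)$, $z\in U_i\cap U_j$. The *holonomy pseudogroup* $\mathcal G_{\mathfrak X}$ is the pseudogroup of local homeomorphisms of $\mathfrak X$ generated by the $h_{i,j}$ with $U_i\cap U_j\neq\emptyset$. A pseudogroup on $\mathfrak X$ is *Lipschitz* for a metric $d$ if for some $C\ge1$ it is generated by finitely many homeomorphisms $h$ between clopen subsets that satisfy $C^{-1}d(w,w')\le d(h(w),h(w'))\le C\,d(w,w')$ for all $w,w'$ in the domain of $h$. *Foliations.* Let $M$ be a smooth Riemannian manifold of dimension $p+q$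 with a $C^1$-foliation $\mathcal F_M$ with leaves of dimension $p$; its foliation charts are $C^1$-diffeomorphisms from open subsets of $M$ onto products of an open box in $\mathbb R^p$ and an open box in $\mathbb R^q$. A *minimal set* of $\mathcal F_M$ is a non-empty closed union of leaves that is minimal with these properties; it is *exceptional* if its image under the $\mathbb R^q$-coordinate of each chart of a foliated atlas is totally disconnected without isolated points. For $\mathcal Z\subset M$, a *good covering* of $\mathcal Z$ is a finite family of foliation charts $\phi_\alpha\colon V_\alpha\to(-1,1)^p\times(-1,1)^q$ with $\mathcal Z\subset\bigcup_\alpha V_\alpha$ such that $\overline{V_\alpha}$ is compact, $\phi_\alpha$ is the restriction of a foliation chart defined on a neighbourhood of $\overline{V_\alpha}$, and $\overline{V_\alpha}\cup\overline{V_\beta}$ lies in the domain of one foliation chart whenever $V_\alpha\cap V_\beta\ne\emptyset$. Let $T_\alpha=\phi_\alpha^{-1}(\{0\}\times(-1,1)^q)$, let $\pi_\alpha\colon V_\alpha\to T_\alpha$ be the projection along plaques, and let $d_{T_\alpha}$ be the path-length metric on $T_\alpha$ of the induced Riemannian metric. **Proposition.** Let $\mathfrak M$ be a minimal matchbox manifold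 with a regular covering $\varphi_1,\dots,\varphi_\nu$, let $\mathcal F_M$ be a $C^1$-foliation of a smooth Riemannian manifold $M$, and let $\mathcal Z\subset M$ be an exceptional minimal set of $\mathcal F_M$. Suppose that there is a homeomorphism $f\colon\mathfrak M\to\mathcal Z$. Then $\mathcal Z$ has a good covering, and for every good covering $\{\phi_\alpha\}$ of $\mathcal Z$ there is a metric $d_{\mathfrak X}$ on $\mathfrak X$ that defines its topology and satisfies: 1. there is a finite partition of $\mathfrak X$ into clopen sets $W_a$, with indices $i_a$ and $\alpha_a$, such that $W_a\subset\mathfrak X_{i_a}$, $f(\tau_{i_a}(W_a))\subset V_{\alpha_a}$, $$d_{\mathfrak X}(w,w')=d_{T_{\alpha_a}}\bigl(\pi_{\alpha_a}(f(\tau_{i_a}(w))),\pi_{\alpha_a}(f(\tau_{i_a}(w')))\bigr)\quad\text{for } w,w'\in W_a,$$ and $d_{\mathfrak X}(w,w')=1$ if $w$ and $w'$ lie in different sets of the partition; 2. there is $C\ge1$ with $C^{-1}d_{\mathfrak X}(w,w')\le d_{\mathfrak X}(h_{i,j}(w),h_{i,j}(w'))\le C\,d_{\mathfrak X}(w,w')$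 for all $i,j$ and all $w,w'\in\mathfrak X_{i,j}$; 3. in particular, the holonomy pseudogroup $\mathcal G_{\mathfrak X}$ is Lipschitz for $d_{\mathfrak X}$. -/

import Mathlib

open Set Filter Topology Bundle
open scoped Manifold ContDiff Bundle ENNReal

noncomputable section

/-! ### Boxes and cubes in `ℝⁿ` -/

/-- The open rectangular box `∏ᵢ (aᵢ, bᵢ)` in `ℝⁿ`. -/
def openBox {n : ℕ} (a b : Fin n → ℝ) : Set (Fin n → ℝ) :=
  Set.pi univ fun i => Ioo (a i) (b i)

/-- The open cube `(-r, r)ⁿ` in `ℝⁿ`. -/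
def openCube (n : ℕ) (r : ℝ) : Set (Fin n → ℝ) :=
  openBox (fun _ => -r) (fun _ => r)

lemma isOpen_openCube (n : ℕ) (r : ℝ) : IsOpen (openCube n r) :=
  isOpen_set_pi finite_univ fun _ _ => isOpen_Ioo

lemma openCube_one_subset_two (n : ℕ) : openCube n 1 ⊆ openCube n 2 := by
  intro x hx i hi
  have h := hx i hi
  simp only [mem_Ioo] at h ⊢
  constructor <;> linarith [h.1, h.2]

/-! ### Pseudogroups and the Lipschitz property -/

/-- The pseudogroup of local homeomorphisms of `X` generated by the set `S`: the smallest collection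
of homeomorphisms between open subsets of `X` that contains `S` and the identity and is closed under
composition, inversion, restriction to open sets and unions of compatible maps. -/
def generatedPseudogroup {X : Type*} [TopologicalSpace X] (S : Set (OpenPartialHomeomorph X X)) :
    Set (OpenPartialHomeomorph X X) :=
  {e | ∀ G : StructureGroupoid X, ClosedUnderRestriction G → (∀ g ∈ S, g ∈ G) → e ∈ G}

/-- `h` distorts the distance function `d` by a factor at most `C` in both directions. -/
def IsBiLipschitzFor {X : Type*} [TopologicalSpace X] (d : X → X → ℝ) (C : ℝ)
    (h : OpenPartialHomeomorph X X) : Prop :=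
  ∀ w ∈ h.source, ∀ w' ∈ h.source,
    C⁻¹ * d w w' ≤ d (h w) (h w') ∧ d (h w) (h w') ≤ C * d w w'

/-- The pseudogroup `𝒢` is Lipschitz with respect to `d`: it is generated by finitely many
homeomorphisms between clopen sets that are bi-Lipschitz with a common constant. -/
def IsLipschitzPseudogroup {X : Type*} [TopologicalSpace X] (d : X → X → ℝ)
    (𝒢 : Set (OpenPartialHomeomorph X X)) : Prop :=
  ∃ (k : ℕ) (h : Fin k → OpenPartialHomeomorph X X) (C : ℝ), 1 ≤ C ∧
    (∀ i, IsClopen (h i).source ∧ IsClopen (h i).target) ∧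
    generatedPseudogroup (range h) = 𝒢 ∧
    ∀ i, IsBiLipschitzFor d C (h i)

/-! ### Matchbox manifolds -/

/-- A foliation chart with values in `ℝⁿ × X`. The homeomorphism `toChart` is the extended chart
`Û → (-2,2)ⁿ × 𝔛_φ`, where the local transverse model `𝔛_φ ⊆ X` is clopen and compact. The chart
proper is its restriction to the preimage of `[-1,1]ⁿ × 𝔛_φ`. -/
structure MatchboxChart (n : ℕ) (𝔐 X : Type*) [TopologicalSpace 𝔐] [TopologicalSpace X] where
  toChart : OpenPartialHomeomorph 𝔐 ((Fin n → ℝ) × X)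
  model : Set X
  isClopen_model : IsClopen model
  isCompact_model : IsCompact model
  target_eq : toChart.target = openCube n 2 ×ˢ model

namespace MatchboxChart

variable {n : ℕ} {𝔐 X : Type*} [TopologicalSpace 𝔐] [TopologicalSpace X]

/-- The open set `U = φ⁻¹((-1,1)ⁿ × 𝔛_φ)`. -/
def dom (φ : MatchboxChart n 𝔐 X) : Set 𝔐 :=
  φ.toChart.source ∩ φ.toChart ⁻¹' (openCube n 1 ×ˢ univ)

/-- The projection `π` along the plaques. -/
def proj (φ : MatchboxChart n 𝔐 X) (z : 𝔐) : X := (φ.toChart z).2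

/-- The section `τ(w) = φ⁻¹(0, w)` of `π`. -/
def sec (φ : MatchboxChart n 𝔐 X) (w : X) : 𝔐 := φ.toChart.symm (0, w)

/-- The leafwise coordinate change `y ↦ λ_ψ (φ⁻¹ (y, w))` along the plaque of `φ` over `w`. -/
def leafwiseChange (φ ψ : MatchboxChart n 𝔐 X) (w : X) (y : Fin n → ℝ) : Fin n → ℝ :=
  (ψ.toChart (φ.toChart.symm (y, w))).1

/-- The leafwise coordinate changes from `φ` to `ψ` are smooth along plaques, and they depend
continuously on the point in the `C^∞` topology. -/
def LeafwiseSmooth (φ ψ : MatchboxChart n 𝔐 X) : Prop :=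
  (∀ v ∈ φ.toChart '' (φ.dom ∩ ψ.dom), ContDiffAt ℝ ∞ (leafwiseChange φ ψ v.2) v.1) ∧
  ∀ k : ℕ, ContinuousOn (fun v : (Fin n → ℝ) × X => iteratedFDeriv ℝ k (leafwiseChange φ ψ v.2) v.1)
    (φ.toChart '' (φ.dom ∩ ψ.dom))

lemma isOpen_dom (φ : MatchboxChart n 𝔐 X) : IsOpen φ.dom :=
  φ.toChart.isOpen_inter_preimage ((isOpen_openCube n 1).prod isOpen_univ)

lemma dom_subset (φ : MatchboxChart n 𝔐 X) : φ.dom ⊆ φ.toChart.source := inter_subset_left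

lemma proj_mem_model (φ : MatchboxChart n 𝔐 X) {z : 𝔐} (hz : z ∈ φ.dom) : φ.proj z ∈ φ.model := by
  have h := φ.toChart.map_source hz.1
  rw [φ.target_eq] at h
  exact h.2

lemma continuousOn_proj (φ : MatchboxChart n 𝔐 X) : ContinuousOn φ.proj φ.dom :=
  continuous_snd.comp_continuousOn (φ.toChart.continuousOn.mono φ.dom_subset)

/-- For `z` in an open set `O ⊆ U`, the local transversal `w ↦ φ⁻¹(λ(z), w)` through `z` is
continuous at `π(z)`, and near `π(z)` it stays in `O` and is a section of `π`. -/
lemma exists_local_section (φ : MatchboxChart n 𝔐 X) {O : Set 𝔐} (hO : IsOpen O) (hOU : O ⊆ φ.dom)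
    {z : 𝔐} (hz : z ∈ O) :
    ∃ s : X → 𝔐, ContinuousAt s (φ.proj z) ∧ s (φ.proj z) = z ∧
      ∀ᶠ w in 𝓝 (φ.proj z), s w ∈ O ∧ φ.proj (s w) = w := by
  have hzs : z ∈ φ.toChart.source := φ.dom_subset (hOU hz)
  have hpt : ((φ.toChart z).1, φ.proj z) = φ.toChart z := rfl
  have hc : ContinuousAt (fun w : X => φ.toChart.symm ((φ.toChart z).1, w)) (φ.proj z) := by
    have h1 : ContinuousAt φ.toChart.symm ((φ.toChart z).1, φ.proj z) := by
      rw [hpt]; exact φ.toChart.continuousAt_symm (φ.toChart.map_source hzs)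
    exact ContinuousAt.comp (f := fun w : X => ((φ.toChart z).1, w)) h1
      (Continuous.prodMk_right _).continuousAt
  have hs : φ.toChart.symm ((φ.toChart z).1, φ.proj z) = z := by
    rw [hpt]; exact φ.toChart.left_inv hzs
  refine ⟨fun w => φ.toChart.symm ((φ.toChart z).1, w), hc, hs, ?_⟩
  have hm : φ.model ∈ 𝓝 (φ.proj z) := φ.isClopen_model.isOpen.mem_nhds (φ.proj_mem_model (hOU hz))
  have hO' := hc.eventually_mem (s := O) (by rw [hs]; exact hO.mem_nhds hz)
  filter_upwards [hm, hO'] with w hw hwO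
  refine ⟨hwO, ?_⟩
  have ht : ((φ.toChart z).1, w) ∈ φ.toChart.target := by
    rw [φ.target_eq]
    exact ⟨openCube_one_subset_two n (hOU hz).2.1, hw⟩
  simp only [proj]
  rw [φ.toChart.right_inv ht]

lemma isOpen_image_proj (φ : MatchboxChart n 𝔐 X) {O : Set 𝔐} (hO : IsOpen O) (hOU : O ⊆ φ.dom) :
    IsOpen (φ.proj '' O) := by
  rw [isOpen_iff_mem_nhds]
  rintro _ ⟨z, hz, rfl⟩
  obtain ⟨s, -, -, h⟩ := φ.exists_local_section hO hOU hz
  filter_upwards [h] with w hw using ⟨s w, hw.1, hw.2⟩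

end MatchboxChart

/-- A smooth `n`-dimensional foliated structure on `𝔐` with charts centred at each point, whose
transverse models are clopen subsets of `X`. For `𝔐` compact, connected and metrizable, and `X`
totally disconnected, separable and metrizable, this is a matchbox manifold. -/
structure MatchboxManifold (n : ℕ) (𝔐 X : Type*) [TopologicalSpace 𝔐] [TopologicalSpace X] where
  chart : 𝔐 → MatchboxChart n 𝔐 X
  mem_dom : ∀ x, x ∈ (chart x).dom
  centred : ∀ x, ((chart x).toChart x).1 = 0
  smooth : ∀ x y, (chart x).LeafwiseSmooth (chart y)

namespace MatchboxManifold

variable {n : ℕ} {𝔐 X : Type*} [TopologicalSpace 𝔐] [TopologicalSpace X]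

/-- The fine topology, with basis the sets `φₓ⁻¹(V × {w})` for `V ⊆ (-1,1)ⁿ` open. -/
@[reducible] def fineTopology (S : MatchboxManifold n 𝔐 X) : TopologicalSpace 𝔐 :=
  TopologicalSpace.generateFrom
    {P | ∃ (x : 𝔐) (w : X) (V : Set (Fin n → ℝ)), w ∈ (S.chart x).model ∧ IsOpen V ∧
      V ⊆ openCube n 1 ∧ P = (S.chart x).toChart.symm '' (V ×ˢ {w})}

/-- The leaf through `x`: its connected component in the fine topology. -/
def leaf (S : MatchboxManifold n 𝔐 X) (x : 𝔐) : Set 𝔐 :=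
  @connectedComponent 𝔐 S.fineTopology x

/-- Every leaf is dense. -/
def IsMinimal (S : MatchboxManifold n 𝔐 X) : Prop := ∀ x, Dense (S.leaf x)

end MatchboxManifold

/-- A regular covering of a matchbox manifold by finitely many foliation charts of its smooth
structure: the transverse models form a disjoint clopen covering of the transversal space `X`, the
overlaps project to clopen sets, and each plaque of a chart meets at most one plaque of another. -/
structure RegularCovering {n : ℕ} {𝔐 X : Type*} [TopologicalSpace 𝔐] [TopologicalSpace X]
    (S : MatchboxManifold n 𝔐 X) (ν : ℕ) where
  chart : Fin ν → MatchboxChart n 𝔐 X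
  smooth : ∀ i x, (chart i).LeafwiseSmooth (S.chart x) ∧ (S.chart x).LeafwiseSmooth (chart i)
  cover : ⋃ i, (chart i).dom = univ
  disjoint_model : Pairwise fun i j => Disjoint (chart i).model (chart j).model
  iUnion_model : ⋃ i, (chart i).model = univ
  isClopen_overlap : ∀ i j, IsClopen ((chart i).proj '' ((chart i).dom ∩ (chart j).dom))
  unique_plaque : ∀ i j, ∀ z ∈ (chart i).dom ∩ (chart j).dom, ∀ z' ∈ (chart i).dom ∩ (chart j).dom,
    (chart i).proj z = (chart i).proj z' → (chart j).proj z = (chart j).proj z'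

namespace RegularCovering

variable {n ν : ℕ} {𝔐 X : Type*} [TopologicalSpace 𝔐] [TopologicalSpace X]
  {S : MatchboxManifold n 𝔐 X}

/-- The intersection `Uᵢ ∩ Uⱼ`. -/
def overlap (R : RegularCovering S ν) (i j : Fin ν) : Set 𝔐 := (R.chart i).dom ∩ (R.chart j).dom

/-- The set `𝔛ᵢⱼ = πᵢ(Uᵢ ∩ Uⱼ)`. -/
def overlapProj (R : RegularCovering S ν) (i j : Fin ν) : Set X :=
  (R.chart i).proj '' R.overlap i j

open Classical in
/-- The underlying function of `hᵢⱼ`, sending `πᵢ(z)` to `πⱼ(z)` for `z ∈ Uᵢ ∩ Uⱼ`; the value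
outside `𝔛ᵢⱼ` is irrelevant. -/
def holonomyFun (R : RegularCovering S ν) (i j : Fin ν) (w : X) : X :=
  if h : w ∈ R.overlapProj i j then (R.chart j).proj h.choose else w

lemma overlap_comm (R : RegularCovering S ν) (i j : Fin ν) : R.overlap i j = R.overlap j i :=
  inter_comm _ _

lemma holonomyFun_proj (R : RegularCovering S ν) (i j : Fin ν) {z : 𝔐} (hz : z ∈ R.overlap i j) :
    R.holonomyFun i j ((R.chart i).proj z) = (R.chart j).proj z := by
  have h : (R.chart i).proj z ∈ R.overlapProj i j := ⟨z, hz, rfl⟩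
  rw [holonomyFun, dif_pos h]
  exact R.unique_plaque i j _ h.choose_spec.1 _ hz h.choose_spec.2

lemma isOpen_overlap (R : RegularCovering S ν) (i j : Fin ν) : IsOpen (R.overlap i j) :=
  (R.chart i).isOpen_dom.inter (R.chart j).isOpen_dom

lemma isOpen_overlapProj (R : RegularCovering S ν) (i j : Fin ν) : IsOpen (R.overlapProj i j) :=
  (R.chart i).isOpen_image_proj (R.isOpen_overlap i j) inter_subset_left

lemma continuousOn_holonomyFun (R : RegularCovering S ν) (i j : Fin ν) :
    ContinuousOn (R.holonomyFun i j) (R.overlapProj i j) := by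
  rintro _ ⟨z, hz, rfl⟩
  apply ContinuousAt.continuousWithinAt
  obtain ⟨s, hs, hsz, hev⟩ :=
    (R.chart i).exists_local_section (R.isOpen_overlap i j) inter_subset_left hz
  have hp : ContinuousAt (R.chart j).proj (s ((R.chart i).proj z)) := by
    rw [hsz]
    exact (R.chart j).continuousOn_proj.continuousAt ((R.chart j).isOpen_dom.mem_nhds hz.2)
  refine (hp.comp hs).congr ?_
  filter_upwards [hev] with w hw
  have h := R.holonomyFun_proj i j hw.1
  rw [hw.2] at h
  exact h.symm

/-- The holonomy homeomorphism `hᵢⱼ : 𝔛ᵢⱼ → 𝔛ⱼᵢ` with `hᵢⱼ(πᵢ(z)) = πⱼ(z)` for `z ∈ Uᵢ ∩ Uⱼ`. -/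
def holonomy (R : RegularCovering S ν) (i j : Fin ν) : OpenPartialHomeomorph X X where
  toFun := R.holonomyFun i j
  invFun := R.holonomyFun j i
  source := R.overlapProj i j
  target := R.overlapProj j i
  map_source' := by
    rintro _ ⟨z, hz, rfl⟩
    rw [R.holonomyFun_proj i j hz]
    exact ⟨z, R.overlap_comm i j ▸ hz, rfl⟩
  map_target' := by
    rintro _ ⟨z, hz, rfl⟩
    rw [R.holonomyFun_proj j i hz]
    exact ⟨z, R.overlap_comm j i ▸ hz, rfl⟩
  left_inv' := by
    rintro _ ⟨z, hz, rfl⟩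
    rw [R.holonomyFun_proj i j hz, R.holonomyFun_proj j i (R.overlap_comm i j ▸ hz)]
  right_inv' := by
    rintro _ ⟨z, hz, rfl⟩
    rw [R.holonomyFun_proj j i hz, R.holonomyFun_proj i j (R.overlap_comm j i ▸ hz)]
  open_source := R.isOpen_overlapProj i j
  open_target := R.isOpen_overlapProj j i
  continuousOn_toFun := R.continuousOn_holonomyFun i j
  continuousOn_invFun := R.continuousOn_holonomyFun j i

/-- The holonomy pseudogroup, generated by the maps `hᵢⱼ` over all pairs with `Uᵢ ∩ Uⱼ ≠ ∅`. -/
def holonomyPseudogroup (R : RegularCovering S ν) : Set (OpenPartialHomeomorph X X) :=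
  generatedPseudogroup {h | ∃ i j, (R.overlap i j).Nonempty ∧ h = R.holonomy i j}

end RegularCovering

/-! ### `C¹` foliations of smooth manifolds -/

section Foliation

variable {p q : ℕ} {M : Type*} [TopologicalSpace M]

/-- The transverse coordinate of `ψ` is locally a function of the transverse coordinate of `φ`. -/
def PlaqueCompatible (φ ψ : OpenPartialHomeomorph M ((Fin p → ℝ) × (Fin q → ℝ))) : Prop :=
  ∀ x ∈ φ.source ∩ ψ.source, ∃ U ∈ 𝓝 x, ∀ y ∈ U, ∀ z ∈ U,
    (φ y).2 = (φ z).2 → (ψ y).2 = (ψ z).2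

/-- The projection `x ↦ φ⁻¹(0, π(x))` of the domain of `φ` along plaques to the transversal
`φ⁻¹({0} × ℝ^q)`. -/
def transversalProj (φ : OpenPartialHomeomorph M ((Fin p → ℝ) × (Fin q → ℝ))) (x : M) : M :=
  φ.symm (0, (φ x).2)

/-- The transversal `T = φ⁻¹({0} × (-1,1)^q)` of a chart onto `(-1,1)^p × (-1,1)^q`. -/
def transversal (φ : OpenPartialHomeomorph M ((Fin p → ℝ) × (Fin q → ℝ))) : Set M :=
  φ.symm '' ({0} ×ˢ openCube q 1)

variable [ChartedSpace (EuclideanSpace ℝ (Fin (p + q))) M]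

/-- A `C¹` diffeomorphism from an open subset of `M` onto a product of open boxes. -/
structure IsBoxChart (φ : OpenPartialHomeomorph M ((Fin p → ℝ) × (Fin q → ℝ))) : Prop where
  target_eq : ∃ (a b : Fin p → ℝ) (a' b' : Fin q → ℝ), φ.target = openBox a b ×ˢ openBox a' b'
  contMDiffOn : ContMDiffOn (𝓡 (p + q)) 𝓘(ℝ, (Fin p → ℝ) × (Fin q → ℝ)) 1 φ φ.source
  contMDiffOn_symm : ContMDiffOn 𝓘(ℝ, (Fin p → ℝ) × (Fin q → ℝ)) (𝓡 (p + q)) 1 φ.symm φ.target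

variable (p q M) in
/-- A `C¹` foliation of `M` with leaves of dimension `p` and codimension `q`, given by a foliated
atlas. -/
structure C1Foliation where
  charts : Set (OpenPartialHomeomorph M ((Fin p → ℝ) × (Fin q → ℝ)))
  isBoxChart : ∀ φ ∈ charts, IsBoxChart φ
  cover : ∀ x, ∃ φ ∈ charts, x ∈ φ.source
  compatible : ∀ φ ∈ charts, ∀ ψ ∈ charts, PlaqueCompatible φ ψ

namespace C1Foliation

/-- `φ` is a foliation chart of `F`, that is, it belongs to the maximal foliated atlas. -/
def IsChart (F : C1Foliation p q M) (φ : OpenPartialHomeomorph M ((Fin p → ℝ) × (Fin q → ℝ))) :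
    Prop :=
  IsBoxChart φ ∧ ∀ ψ ∈ F.charts, PlaqueCompatible φ ψ ∧ PlaqueCompatible ψ φ

/-- `x` and `y` lie in a common plaque of the atlas. -/
def SamePlaque (F : C1Foliation p q M) (x y : M) : Prop :=
  ∃ φ ∈ F.charts, x ∈ φ.source ∧ y ∈ φ.source ∧ (φ x).2 = (φ y).2

/-- The leaf through `x`: the points that are joined to `x` by a finite chain of plaques. -/
def leaf (F : C1Foliation p q M) (x : M) : Set M := {y | Relation.EqvGen F.SamePlaque x y}

/-- `Z` is a union of leaves. -/
def IsSaturated (F : C1Foliation p q M) (Z : Set M) : Prop := ∀ x ∈ Z, F.leaf x ⊆ Z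

/-- `Z` is minimal among the non-empty closed saturated sets. -/
structure IsMinimalSet (F : C1Foliation p q M) (Z : Set M) : Prop where
  nonempty : Z.Nonempty
  isClosed : IsClosed Z
  isSaturated : F.IsSaturated Z
  minimal : ∀ Z' ⊆ Z, Z'.Nonempty → IsClosed Z' → F.IsSaturated Z' → Z' = Z

/-- The minimal set `Z` is exceptional: in each chart its trace on the transverse coordinates,
which is relatively closed, is totally disconnected without isolated points, so it is locally a
Cantor set. -/
structure IsExceptionalMinimalSet (F : C1Foliation p q M) (Z : Set M) : Prop
    extends F.IsMinimalSet Z where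
  isTotallyDisconnected : ∀ φ ∈ F.charts,
    IsTotallyDisconnected ((fun x => (φ x).2) '' (Z ∩ φ.source))
  preperfect : ∀ φ ∈ F.charts, Preperfect ((fun x => (φ x).2) '' (Z ∩ φ.source))

/-- A finite family of good foliation charts `V_α → (-1,1)^p × (-1,1)^q` whose domains cover `Z`:
each is the restriction of a foliation chart defined on a neighbourhood of the compact closure of
`V_α`, and if two domains meet, then both closures lie in the domain of one foliation chart. -/
structure IsGoodCovering (F : C1Foliation p q M) (Z : Set M) {k : ℕ}
    (V : Fin k → OpenPartialHomeomorph M ((Fin p → ℝ) × (Fin q → ℝ))) : Prop where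
  isChart : ∀ α, F.IsChart (V α)
  target_eq : ∀ α, (V α).target = openCube p 1 ×ˢ openCube q 1
  cover : Z ⊆ ⋃ α, (V α).source
  extension : ∀ α, IsCompact (closure (V α).source) ∧
    ∃ ψ, F.IsChart ψ ∧ closure (V α).source ⊆ ψ.source ∧ EqOn (V α) ψ (V α).source
  overlap : ∀ α β, ((V α).source ∩ (V β).source).Nonempty →
    ∃ ψ, F.IsChart ψ ∧ closure (V α).source ∪ closure (V β).source ⊆ ψ.source

end C1Foliation

/-- The path-length distance on a subset `T` of a Riemannian manifold: the infimum of the lengths of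
the `C¹` paths from `x` to `y` that lie in `T`. -/
def pathEDistIn [RiemannianBundle (fun x : M => TangentSpace (𝓡 (p + q)) x)] (T : Set M) (x y : M) :
    ℝ≥0∞ :=
  ⨅ (γ : ℝ → M) (_ : ContMDiffOn 𝓘(ℝ) (𝓡 (p + q)) 1 γ (Icc 0 1) ∧
    MapsTo γ (Icc 0 1) T ∧ γ 0 = x ∧ γ 1 = y), Manifold.pathELength (𝓡 (p + q)) γ 0 1

/-- The distance function `d` on the transversal space `X` is pulled back from the transversals of
the charts `V`: for a finite clopen partition `W` of `X`, subordinate to the models of `R`, the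
section `τ` followed by `f` maps `W a` into the domain of a chart `V_α`, on `W a` the distance is the
path-length distance in `T_α` between the projections of `f (τ w)` and `f (τ w')`, and distinct
members of the partition are at distance one. -/
def IsPulledBackFrom [RiemannianBundle (fun x : M => TangentSpace (𝓡 (p + q)) x)]
    {n ν k : ℕ} {𝔐 X : Type*} [TopologicalSpace 𝔐] [TopologicalSpace X]
    {S : MatchboxManifold n 𝔐 X} (R : RegularCovering S ν) (f : 𝔐 → M)
    (V : Fin k → OpenPartialHomeomorph M ((Fin p → ℝ) × (Fin q → ℝ))) (d : X → X → ℝ) : Prop :=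
  ∃ (m : ℕ) (W : Fin m → Set X) (i : Fin m → Fin ν) (α : Fin m → Fin k),
    (∀ a, IsClopen (W a)) ∧ (Pairwise fun a b => Disjoint (W a) (W b)) ∧ ⋃ a, W a = univ ∧
    (∀ a, W a ⊆ (R.chart (i a)).model) ∧
    (∀ a, ∀ w ∈ W a, f ((R.chart (i a)).sec w) ∈ (V (α a)).source) ∧
    (∀ a, ∀ w ∈ W a, ∀ w' ∈ W a,
      ENNReal.ofReal (d w w') =
        pathEDistIn (p := p) (q := q) (transversal (V (α a)))
          (transversalProj (V (α a)) (f ((R.chart (i a)).sec w)))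
          (transversalProj (V (α a)) (f ((R.chart (i a)).sec w')))) ∧
    ∀ a b, a ≠ b → ∀ w ∈ W a, ∀ w' ∈ W b, d w w' = 1

end Foliation

end

/-!
The metric is transported from the transversals of the good charts. In the transverse coordinate of
a good chart, its path-length distance is comparable with the sup distance of `ℝ^q`: the chart
extends over the compact closure of its domain, so the velocities of curves are distorted by a
bounded factor in both directions (`exists_pathEDistIn_transversal_comparison`). All questions about
the distance thus become questions about the coordinates `κ(w) = (φ_α (f (τ_i w))).2`, which are
defined near each point of the transversal space.

Near each point, `κ` is continuous and injective. For the injectivity, a small plaque of `F` that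
meets `Z` lies in `Z`, because `Z` is saturated; it is connected, so `f⁻¹` maps it into a single
plaque of the matchbox manifold, because the transversal space is totally disconnected
(`MatchboxChart.exists_nhds_injOn_transverse`). On a sufficiently fine clopen partition the pulled
back distances are therefore distances bounded by one, and extended by one they give a metric. It is
continuous on a compact space, so it defines the topology.

The holonomy maps are locally Lipschitz in the coordinates `κ`. Conversely to the above, `f` maps
small plaques of a matchbox chart into plaques of `F`, because `Z` has a totally disconnected trace
on the transverse coordinates (`MatchboxChart.exists_nhds_transverse_eq`). When a point moves along
a plaque of a matchbox chart, the germ of `κ` hence only changes when the foliation chart is changed,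
and then by a `C¹` map. As the plaque is connected, the germs of `κ` at its points are Lipschitz
functions of each other (`MatchboxChart.lipDominates_plaque`); moving along a plaque of the `i`-th
chart and then along one of the `j`-th chart yields the claim for `hᵢⱼ`. By compactness the maps
`hᵢⱼ` are Lipschitz, and they are bi-Lipschitz because `hⱼᵢ` is the inverse of `hᵢⱼ`.

Good coverings exist because `Z` is compact: one takes unit cubes in rescaled foliation charts that
are small compared with a Lebesgue number of the atlas (`C1Foliation.exists_isGoodCovering`).
-/

noncomputable section

/-! ### Derivative bounds for maps into and out of a Riemannian manifold -/

section DerivativeBounds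

open Manifold
open scoped NNReal

variable {E G M : Type*} [NormedAddCommGroup E] [NormedSpace ℝ E]
  [NormedAddCommGroup G] [NormedSpace ℝ G] [TopologicalSpace M] [ChartedSpace E M]
  [RiemannianBundle (fun x : M => TangentSpace 𝓘(ℝ, E) x)]

lemma IsContMDiffRiemannianBundle.isContinuousRiemannianBundle_tangentSpace {n : WithTop ℕ∞}
    {N : Type*} [TopologicalSpace N] [ChartedSpace E N] [IsManifold 𝓘(ℝ, E) 1 N]
    [RiemannianBundle (fun x : N => TangentSpace 𝓘(ℝ, E) x)]
    (h : IsContMDiffRiemannianBundle 𝓘(ℝ, E) n E (fun x : N => TangentSpace 𝓘(ℝ, E) x)) :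
    IsContinuousRiemannianBundle E (fun x : N => TangentSpace 𝓘(ℝ, E) x) := by
  obtain ⟨g, hg, hg'⟩ := h.exists_contMDiff
  exact ⟨g, hg.continuous, hg'⟩

lemma ContDiffAt.eventually_enorm_fderiv_le {F : Type*} [NormedAddCommGroup F] [NormedSpace ℝ F]
    {g : F → G} {u : F} (hg : ContDiffAt ℝ 1 g u) :
    ∃ C : ℝ≥0, ∀ᶠ v in 𝓝 u, DifferentiableAt ℝ g v ∧ ‖fderiv ℝ g v‖ₑ ≤ C := by
  refine ⟨‖fderiv ℝ g u‖₊ + 1, ?_⟩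
  have h := (hg.continuousAt_fderiv one_ne_zero).nnnorm
  filter_upwards [h.eventually_lt continuousAt_const (lt_add_one _), hg.eventually (by simp)]
    with v hv hv'
  refine ⟨hv'.differentiableAt one_ne_zero, ?_⟩
  simp only [enorm]
  exact_mod_cast hv.le

lemma enorm_deriv_comp_le {F : Type*} [NormedAddCommGroup F] [NormedSpace ℝ F] {g : F → G}
    {γ : ℝ → F} {t : ℝ} {D : ℝ≥0} (hg : DifferentiableAt ℝ g (γ t))
    (hD : ‖fderiv ℝ g (γ t)‖ₑ ≤ D) (hγ : DifferentiableAt ℝ γ t) :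
    ‖deriv (g ∘ γ) t‖ₑ ≤ D * ‖deriv γ t‖ₑ := by
  rw [fderiv_comp_deriv t hg hγ]
  refine (ContinuousLinearMap.le_opENorm _ _).trans ?_
  gcongr

/-- The two velocities lie in the tangent spaces at `γ t` and `γ' t`, whose norms are only
propositionally the same. -/
lemma enorm_mfderiv_congr {γ γ' : ℝ → M} {t : ℝ} (h : γ =ᶠ[𝓝 t] γ') :
    ‖mfderiv 𝓘(ℝ) 𝓘(ℝ, E) γ t 1‖ₑ = ‖mfderiv 𝓘(ℝ) 𝓘(ℝ, E) γ' t 1‖ₑ := by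
  have key : ∀ (a b : M) (v : E), a = b → ‖(show TangentSpace 𝓘(ℝ, E) a from v)‖ₑ =
      ‖(show TangentSpace 𝓘(ℝ, E) b from v)‖ₑ := by
    rintro a _ v rfl; rfl
  have h2 : (mfderiv 𝓘(ℝ) 𝓘(ℝ, E) γ t 1 : E) = mfderiv 𝓘(ℝ) 𝓘(ℝ, E) γ' t 1 :=
    congr($(h.mfderiv_eq) 1)
  refine (key _ _ _ h.eq_of_nhds).trans ?_
  exact congrArg (fun v : E => ‖(show TangentSpace 𝓘(ℝ, E) (γ' t) from v)‖ₑ) h2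

/-- Along a path that stays in `K`, the map `g` increases lengths at most by the factor by which it
increases velocities. -/
lemma enorm_sub_le_mul_pathELength {g : M → G} {K : Set M} {C : ℝ≥0}
    (hg : ∀ x ∈ K, ContMDiffAt 𝓘(ℝ, E) 𝓘(ℝ, G) 1 g x)
    (hC : ∀ (γ : ℝ → M) (t : ℝ), γ t ∈ K → MDifferentiableAt 𝓘(ℝ) 𝓘(ℝ, E) γ t →
      ‖deriv (g ∘ γ) t‖ₑ ≤ C * ‖mfderiv 𝓘(ℝ) 𝓘(ℝ, E) γ t 1‖ₑ)
    {γ : ℝ → M} (hγ : ContMDiffOn 𝓘(ℝ) 𝓘(ℝ, E) 1 γ (Icc 0 1)) (hK : MapsTo γ (Icc 0 1) K) :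
    ‖g (γ 1) - g (γ 0)‖ₑ ≤ C * pathELength 𝓘(ℝ, E) γ 0 1 := by
  have h1 : ContDiffOn ℝ 1 (g ∘ γ) (Icc 0 1) := by
    rw [← contMDiffOn_iff_contDiffOn]
    exact fun t ht => (hg _ (hK ht)).comp_contMDiffWithinAt t (hγ t ht)
  refine (enorm_sub_le_lintegral_deriv_of_contDiffOn_Icc h1 zero_le_one).trans ?_
  rw [pathELength_eq_lintegral_mfderiv_Ioo, ← MeasureTheory.lintegral_const_mul' _ _
    ENNReal.coe_ne_top, ← MeasureTheory.restrict_Ioo_eq_restrict_Icc]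
  refine MeasureTheory.setLIntegral_mono' measurableSet_Ioo fun t ht => ?_
  refine hC γ t (hK ⟨ht.1.le, ht.2.le⟩) ?_
  exact ((hγ t ⟨ht.1.le, ht.2.le⟩).contMDiffAt (Icc_mem_nhds ht.1 ht.2)).mdifferentiableAt
    one_ne_zero

/-- The image of a segment has length at most the length of the segment times the factor by which
the map increases velocities. -/
lemma pathELength_comp_lineMap_le {g : G → M} {K : Set G} {C : ℝ≥0}
    (hC : ∀ (γ : ℝ → G) (t : ℝ), γ t ∈ K → DifferentiableAt ℝ γ t →
      ‖mfderiv 𝓘(ℝ) 𝓘(ℝ, E) (g ∘ γ) t 1‖ₑ ≤ C * ‖deriv γ t‖ₑ) {u v : G}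
    (huv : segment ℝ u v ⊆ K) :
    pathELength 𝓘(ℝ, E) (g ∘ AffineMap.lineMap u v) 0 1 ≤ C * ‖v - u‖ₑ := by
  rw [pathELength_eq_lintegral_mfderiv_Icc]
  refine (MeasureTheory.setLIntegral_mono' (g := fun _ => C * ‖v - u‖ₑ) measurableSet_Icc
    fun t ht => ?_).trans (by simp)
  have h := AffineMap.hasDerivAt_lineMap (a := u) (b := v) (x := t)
  rw [← h.deriv]
  refine hC _ t (huv ?_) h.differentiableAt
  rw [segment_eq_image_lineMap]
  exact mem_image_of_mem _ ht

variable [IsManifold 𝓘(ℝ, E) 1 M]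
  [IsContinuousRiemannianBundle E (fun x : M => TangentSpace 𝓘(ℝ, E) x)]

lemma eventually_enorm_deriv_extChartAt_comp_le (x : M) :
    ∃ C : ℝ≥0, ∀ᶠ y in 𝓝 x, ∀ (γ : ℝ → M) (t : ℝ), γ t = y →
      MDifferentiableAt 𝓘(ℝ) 𝓘(ℝ, E) γ t →
        ‖deriv (extChartAt 𝓘(ℝ, E) x ∘ γ) t‖ₑ ≤ C * ‖mfderiv 𝓘(ℝ) 𝓘(ℝ, E) γ t 1‖ₑ := by
  obtain ⟨C, C0, hC⟩ := eventually_enorm_mfderiv_extChartAt_lt 𝓘(ℝ, E) x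
  refine ⟨C, ?_⟩
  filter_upwards [hC, chart_source_mem_nhds E x] with y hy hs γ t hγt hγ
  subst hγt
  have h1 : MDifferentiableAt 𝓘(ℝ, E) 𝓘(ℝ, E) (extChartAt 𝓘(ℝ, E) x) (γ t) :=
    mdifferentiableAt_extChartAt hs
  have h2 : deriv (extChartAt 𝓘(ℝ, E) x ∘ γ) t =
      mfderiv 𝓘(ℝ, E) 𝓘(ℝ, E) (extChartAt 𝓘(ℝ, E) x) (γ t) (mfderiv 𝓘(ℝ) 𝓘(ℝ, E) γ t 1) := by
    rw [← fderiv_apply_one_eq_deriv, ← mfderiv_eq_fderiv, mfderiv_comp t h1 hγ]; rfl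
  rw [h2]
  refine (ContinuousLinearMap.le_opENorm _ _).trans ?_
  gcongr
  exact hy.le

section

-- The derivative of the inverse chart is a map out of a tangent space of `E`, which has to carry
-- the norm of `E`.
attribute [local instance] normedAddCommGroupTangentSpaceVectorSpace
  normedSpaceTangentSpaceVectorSpace

lemma eventually_enorm_mfderiv_extChartAt_symm_comp_le (x : M) :
    ∃ C : ℝ≥0, ∀ᶠ v in 𝓝 (extChartAt 𝓘(ℝ, E) x x), ∀ (γ : ℝ → E) (t : ℝ), γ t = v →
      DifferentiableAt ℝ γ t →
        ‖mfderiv 𝓘(ℝ) 𝓘(ℝ, E) ((extChartAt 𝓘(ℝ, E) x).symm ∘ γ) t 1‖ₑ ≤ C * ‖deriv γ t‖ₑ := by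
  obtain ⟨C, C0, hC⟩ := eventually_enorm_mfderivWithin_symm_extChartAt_lt 𝓘(ℝ, E) x
  refine ⟨C, ?_⟩
  simp only [modelWithCornersSelf_coe, range_id, nhdsWithin_univ, mfderivWithin_univ] at hC
  filter_upwards [hC, extChartAt_target_mem_nhds (I := 𝓘(ℝ, E)) x] with v hv hs γ t hγt hγ
  subst hγt
  have h1 : MDifferentiableAt 𝓘(ℝ, E) 𝓘(ℝ, E) (extChartAt 𝓘(ℝ, E) x).symm (γ t) := by
    rw [← mdifferentiableWithinAt_univ, ← range_id, ← modelWithCornersSelf_coe ℝ E]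
    exact mdifferentiableWithinAt_extChartAt_symm hs
  have h2 : mfderiv 𝓘(ℝ) 𝓘(ℝ, E) ((extChartAt 𝓘(ℝ, E) x).symm ∘ γ) t 1 =
      mfderiv 𝓘(ℝ, E) 𝓘(ℝ, E) (extChartAt 𝓘(ℝ, E) x).symm (γ t) (deriv γ t) := by
    have h3 : mfderiv 𝓘(ℝ) 𝓘(ℝ, E) γ t 1 = deriv γ t := by
      rw [mfderiv_eq_fderiv]; exact fderiv_apply_one_eq_deriv (𝕜 := ℝ) (F := E) (f := γ) (x := t)
    exact congr($(mfderiv_comp t h1 hγ.mdifferentiableAt) 1).trans (congrArg _ h3)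
  rw [h2]
  exact (ContinuousLinearMap.le_opENorm _ _).trans (mul_le_mul_left hv.le _)

end

/-- A `C¹` map from a Riemannian manifold to a normed space is infinitesimally Lipschitz, with a
constant that is locally uniform. The bound is phrased in terms of velocities of curves. -/
lemma ContMDiffAt.eventually_enorm_deriv_comp_le {g : M → G} {x : M}
    (hg : ContMDiffAt 𝓘(ℝ, E) 𝓘(ℝ, G) 1 g x) :
    ∃ C : ℝ≥0, ∀ᶠ y in 𝓝 x, ∀ (γ : ℝ → M) (t : ℝ), γ t = y →
      MDifferentiableAt 𝓘(ℝ) 𝓘(ℝ, E) γ t →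
        ‖deriv (g ∘ γ) t‖ₑ ≤ C * ‖mfderiv 𝓘(ℝ) 𝓘(ℝ, E) γ t 1‖ₑ := by
  obtain ⟨C, hC⟩ := eventually_enorm_deriv_extChartAt_comp_le (E := E) x
  set e := extChartAt 𝓘(ℝ, E) x with he
  have h1 : ContDiffAt ℝ 1 (g ∘ e.symm) (e x) := by
    have hg' : ContMDiffAt 𝓘(ℝ, E) 𝓘(ℝ, G) 1 g (e.symm (e x)) := by
      rwa [he, extChartAt_to_inv]
    have he' : ContMDiffAt 𝓘(ℝ, E) 𝓘(ℝ, E) 1 e.symm (e x) :=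
      (contMDiffOn_extChartAt_symm x).contMDiffAt (extChartAt_target_mem_nhds x)
    exact (hg'.comp (e x) he').contDiffAt
  obtain ⟨D, hD⟩ := h1.eventually_enorm_fderiv_le
  refine ⟨D * C, ?_⟩
  filter_upwards [hC, (continuousAt_extChartAt x).eventually hD,
    (extChartAt_source_mem_nhds x : e.source ∈ 𝓝 x)] with y hy hy' hs γ t hγt hγ
  have h3 : g ∘ γ =ᶠ[𝓝 t] (g ∘ e.symm) ∘ (e ∘ γ) := by
    have : ∀ᶠ s in 𝓝 t, γ s ∈ e.source := hγ.continuousAt.eventually (by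
      rw [hγt]; exact (isOpen_extChartAt_source x).mem_nhds hs)
    filter_upwards [this] with s hs
    simp [e.left_inv hs]
  have h4 : DifferentiableAt ℝ (e ∘ γ) t := by
    rw [← mdifferentiableAt_iff_differentiableAt]
    exact MDifferentiableAt.comp t (I' := 𝓘(ℝ, E))
      (mdifferentiableAt_extChartAt (by simpa [hγt, he] using hs)) hγ
  subst hγt
  rw [h3.deriv_eq, ENNReal.coe_mul, mul_assoc]
  refine (enorm_deriv_comp_le (g := g ∘ e.symm) (γ := e ∘ γ) hy'.1 hy'.2 h4).trans ?_
  exact mul_le_mul_right (hy γ t rfl hγ) _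

/-- A `C¹` map from a normed space to a Riemannian manifold is infinitesimally Lipschitz, with a
constant that is locally uniform. -/
lemma ContMDiffAt.eventually_enorm_mfderiv_comp_le {g : G → M} {u : G}
    (hg : ContMDiffAt 𝓘(ℝ, G) 𝓘(ℝ, E) 1 g u) :
    ∃ C : ℝ≥0, ∀ᶠ v in 𝓝 u, ∀ (γ : ℝ → G) (t : ℝ), γ t = v → DifferentiableAt ℝ γ t →
      ‖mfderiv 𝓘(ℝ) 𝓘(ℝ, E) (g ∘ γ) t 1‖ₑ ≤ C * ‖deriv γ t‖ₑ := by
  obtain ⟨C, hC⟩ := eventually_enorm_mfderiv_extChartAt_symm_comp_le (E := E) (g u)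
  set e := extChartAt 𝓘(ℝ, E) (g u) with he
  have h1 : ContDiffAt ℝ 1 (e ∘ g) u := by
    exact ((contMDiffAt_extChartAt (I := 𝓘(ℝ, E)) (x := g u)).comp u hg).contDiffAt
  obtain ⟨D, hD⟩ := h1.eventually_enorm_fderiv_le
  refine ⟨C * D, ?_⟩
  have hs : ∀ᶠ v in 𝓝 u, ∀ᶠ w in 𝓝 v, g w ∈ e.source :=
    (hg.continuousAt.eventually (extChartAt_source_mem_nhds (g u))).eventually_nhds
  filter_upwards [h1.continuousAt.eventually hC, hD, hs] with v hv hv' hs γ t hγt hγ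
  subst hγt
  have h3 : g ∘ γ =ᶠ[𝓝 t] e.symm ∘ ((e ∘ g) ∘ γ) := by
    filter_upwards [hγ.continuousAt.eventually hs] with s hs
    simp [e.left_inv hs]
  rw [enorm_mfderiv_congr (E := E) h3, ENNReal.coe_mul, mul_assoc]
  refine (hv ((e ∘ g) ∘ γ) t rfl (hv'.1.comp t hγ)).trans ?_
  gcongr
  exact enorm_deriv_comp_le hv'.1 hv'.2 hγ

/-- Constants that exist locally and may be enlarged exist uniformly on compact sets. -/
lemma IsCompact.exists_forall_of_eventually {X : Type*} [TopologicalSpace X] {K : Set X}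
    (hK : IsCompact K) {P : ℝ≥0 → X → Prop} (hP : ∀ C D x, C ≤ D → P C x → P D x)
    (h : ∀ x ∈ K, ∃ C, ∀ᶠ y in 𝓝 x, P C y) : ∃ C, ∀ x ∈ K, P C x := by
  refine hK.induction_on (p := fun s => ∃ C, ∀ x ∈ s, P C x) ⟨0, by simp⟩ ?_ ?_ ?_
  · exact fun s t hst ⟨C, hC⟩ => ⟨C, fun x hx => hC x (hst hx)⟩
  · rintro s t ⟨C, hC⟩ ⟨D, hD⟩
    refine ⟨max C D, fun x hx => hx.elim (fun h => ?_) fun h => ?_⟩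
    · exact hP _ _ _ (le_max_left C D) (hC x h)
    · exact hP _ _ _ (le_max_right C D) (hD x h)
  · intro x hx
    obtain ⟨C, hC⟩ := h x hx
    exact ⟨_, mem_nhdsWithin_of_mem_nhds hC, C, fun y hy => hy⟩

lemma IsCompact.exists_enorm_deriv_comp_le {g : M → G} {K : Set M} (hK : IsCompact K)
    (hg : ∀ x ∈ K, ContMDiffAt 𝓘(ℝ, E) 𝓘(ℝ, G) 1 g x) :
    ∃ C : ℝ≥0, ∀ (γ : ℝ → M) (t : ℝ), γ t ∈ K → MDifferentiableAt 𝓘(ℝ) 𝓘(ℝ, E) γ t →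
      ‖deriv (g ∘ γ) t‖ₑ ≤ C * ‖mfderiv 𝓘(ℝ) 𝓘(ℝ, E) γ t 1‖ₑ := by
  obtain ⟨C, hC⟩ := hK.exists_forall_of_eventually
    (P := fun C y => ∀ (γ : ℝ → M) (t : ℝ), γ t = y → MDifferentiableAt 𝓘(ℝ) 𝓘(ℝ, E) γ t →
      ‖deriv (g ∘ γ) t‖ₑ ≤ C * ‖mfderiv 𝓘(ℝ) 𝓘(ℝ, E) γ t 1‖ₑ)
    (fun C D x hCD h γ t h1 h2 => (h γ t h1 h2).trans (by gcongr))
    fun x hx => (hg x hx).eventually_enorm_deriv_comp_le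
  exact ⟨C, fun γ t ht => hC _ ht γ t rfl⟩

lemma IsCompact.exists_enorm_mfderiv_comp_le {g : G → M} {K : Set G} (hK : IsCompact K)
    (hg : ∀ x ∈ K, ContMDiffAt 𝓘(ℝ, G) 𝓘(ℝ, E) 1 g x) :
    ∃ C : ℝ≥0, ∀ (γ : ℝ → G) (t : ℝ), γ t ∈ K → DifferentiableAt ℝ γ t →
      ‖mfderiv 𝓘(ℝ) 𝓘(ℝ, E) (g ∘ γ) t 1‖ₑ ≤ C * ‖deriv γ t‖ₑ := by
  obtain ⟨C, hC⟩ := hK.exists_forall_of_eventually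
    (P := fun C y => ∀ (γ : ℝ → G) (t : ℝ), γ t = y → DifferentiableAt ℝ γ t →
      ‖mfderiv 𝓘(ℝ) 𝓘(ℝ, E) (g ∘ γ) t 1‖ₑ ≤ C * ‖deriv γ t‖ₑ)
    (fun C D x hCD h γ t h1 h2 => (h γ t h1 h2).trans (by gcongr))
    fun x hx => (hg x hx).eventually_enorm_mfderiv_comp_le
  exact ⟨C, fun γ t ht => hC _ ht γ t rfl⟩

end DerivativeBounds

/-! ### The path-length distance on a subset -/

section PathEDistIn

open Manifold

variable {p q : ℕ} {M : Type*} [TopologicalSpace M]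
  [ChartedSpace (EuclideanSpace ℝ (Fin (p + q))) M]
  [RiemannianBundle (fun x : M => TangentSpace (𝓡 (p + q)) x)] {T : Set M} {x y z : M}

lemma pathEDistIn_le_of_path {γ : ℝ → M} (hγ : ContMDiffOn 𝓘(ℝ) (𝓡 (p + q)) 1 γ (Icc 0 1))
    (hT : MapsTo γ (Icc 0 1) T) (h0 : γ 0 = x) (h1 : γ 1 = y) :
    pathEDistIn (p := p) (q := q) T x y ≤ pathELength (𝓡 (p + q)) γ 0 1 :=
  biInf_le (fun γ => pathELength (𝓡 (p + q)) γ 0 1) ⟨hγ, hT, h0, h1⟩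

lemma pathEDistIn_self (hx : x ∈ T) : pathEDistIn (p := p) (q := q) T x x = 0 := by
  refine le_antisymm ((pathEDistIn_le_of_path (γ := fun _ => x) contMDiffOn_const
    (fun _ _ => hx) rfl rfl).trans ?_) bot_le
  simp [pathELength_eq_lintegral_mfderiv_Icc, mfderiv_const]

/-- A path in `T` can be reparametrized so that it stops near its endpoints, which makes it possible
to concatenate `C¹` paths. -/
lemma exists_locally_constant_path_of_pathEDistIn_lt {r : ℝ≥0∞}
    (hr : pathEDistIn (p := p) (q := q) T x y < r) {a b : ℝ} (hab : a < b) :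
    ∃ γ : ℝ → M, ContMDiff 𝓘(ℝ) (𝓡 (p + q)) 1 γ ∧ (∀ t, γ t ∈ T) ∧ γ a = x ∧ γ b = y ∧
      pathELength (𝓡 (p + q)) γ a b < r ∧ γ =ᶠ[𝓝 a] (fun _ => x) ∧ γ =ᶠ[𝓝 b] fun _ => y := by
  simp only [pathEDistIn, iInf_lt_iff, exists_prop] at hr
  obtain ⟨γ, ⟨γ_smooth, γT, hγx, hγy⟩, hγ⟩ := hr
  obtain ⟨a', haa', ha'b⟩ := exists_between hab
  obtain ⟨b', ha'b', hb'b⟩ := exists_between ha'b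
  let η (t : ℝ) : ℝ := Real.smoothTransition ((b' - a')⁻¹ * (t - a'))
  have η_smooth : ContDiff ℝ 1 η := by fun_prop
  have A (t) (ht : t < a') : η t = 0 := by
    simp only [η, Real.smoothTransition.zero_iff_nonpos]
    apply mul_nonpos_of_nonneg_of_nonpos
    · simpa using ha'b'.le
    · linarith
  have A' (t) (ht : t < a') : (γ ∘ η) t = x := by simp [A t ht, hγx]
  have B (t) (ht : b' < t) : η t = 1 := by
    simp only [η, Real.smoothTransition.eq_one_iff_one_le, inv_mul_eq_div]
    rw [one_le_div₀] <;> linarith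
  have B' (t) (ht : b' < t) : (γ ∘ η) t = y := by simp [B t ht, hγy]
  have η_mem (t) : η t ∈ Icc (0 : ℝ) 1 :=
    ⟨Real.smoothTransition.nonneg _, Real.smoothTransition.le_one _⟩
  refine ⟨γ ∘ η, ?_, fun t => γT (η_mem t), A' _ haa', B' _ hb'b, ?_, ?_, ?_⟩
  · rw [← contMDiffOn_univ]
    refine γ_smooth.comp ?_ fun t _ => η_mem t
    rw [contMDiffOn_univ, contMDiff_iff_contDiff]
    exact η_smooth
  · convert! hγ using 1
    rw [← A a haa', ← B b hb'b]
    apply pathELength_comp_of_monotoneOn hab.le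
    · apply Monotone.monotoneOn
      apply Real.smoothTransition.monotone.comp
      intro t u htu
      dsimp only
      gcongr
    · exact η_smooth.contDiffOn.differentiableOn one_ne_zero
    · rw [A a haa', B b hb'b]
      exact γ_smooth.mdifferentiableOn one_ne_zero
  · filter_upwards [Iio_mem_nhds haa'] with t ht using A' t ht
  · filter_upwards [Ioi_mem_nhds hb'b] with t ht using B' t ht

lemma pathEDistIn_comm :
    pathEDistIn (p := p) (q := q) T x y = pathEDistIn (p := p) (q := q) T y x := by
  suffices H : ∀ x y, pathEDistIn (p := p) (q := q) T y x ≤ pathEDistIn (p := p) (q := q) T x y from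
    le_antisymm (H y x) (H x y)
  intro x y
  refine le_iInf₂ fun γ ⟨hγ, hT, h0, h1⟩ => ?_
  let η : ℝ → ℝ := fun t => 1 - t
  have hη : MapsTo η (Icc 0 1) (Icc 0 1) := fun t ht => by
    simp only [η, mem_Icc] at ht ⊢; constructor <;> linarith
  have η_diff : Differentiable ℝ η := by fun_prop
  have hs : ContMDiffOn 𝓘(ℝ) (𝓡 (p + q)) 1 (γ ∘ η) (Icc 0 1) := by
    refine hγ.comp ?_ hη
    rw [contMDiffOn_iff_contDiffOn]
    fun_prop
  refine (pathEDistIn_le_of_path hs (hT.comp hη) (by simpa [η]) (by simpa [η])).trans_eq ?_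
  rw [pathELength_comp_of_antitoneOn zero_le_one (fun s _ t _ h => by simp only [η]; linarith)
    η_diff.differentiableOn]
  · simp [η]
  · simpa [η] using hγ.mdifferentiableOn one_ne_zero

lemma pathEDistIn_triangle : pathEDistIn (p := p) (q := q) T x z ≤
    pathEDistIn (p := p) (q := q) T x y + pathEDistIn (p := p) (q := q) T y z := by
  refine le_of_forall_gt fun r hr => ?_
  obtain ⟨u, hu, v, hv, huv⟩ := ENNReal.exists_add_lt_of_add_lt hr
  have half_lt : (1 / 2 : ℝ) < 1 := by norm_num
  have half_pos : (0 : ℝ) < 1 / 2 := by norm_num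
  obtain ⟨γ₁, hγ₁, hT₁, hγ₁0, hγ₁1, hγ₁u, -, hγ₁c⟩ :=
    exists_locally_constant_path_of_pathEDistIn_lt hu half_pos
  obtain ⟨γ₂, hγ₂, hT₂, hγ₂0, hγ₂1, hγ₂v, hγ₂c, -⟩ :=
    exists_locally_constant_path_of_pathEDistIn_lt hv half_lt
  let γ := piecewise (Iic (1 / 2)) γ₁ γ₂
  have hγ : ContMDiff 𝓘(ℝ) (𝓡 (p + q)) 1 γ :=
    ContMDiff.piecewise_Iic hγ₁ hγ₂ (hγ₁c.trans hγ₂c.symm)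
  have hγT : MapsTo γ (Icc 0 1) T := fun t _ => by
    by_cases ht : t ∈ Iic (1 / 2 : ℝ)
    · simpa only [γ, piecewise_eq_of_mem _ _ _ ht] using hT₁ t
    · simpa only [γ, piecewise_eq_of_notMem _ _ _ ht] using hT₂ t
  have h0 : γ 0 = x := by
    rw [← hγ₁0]; exact piecewise_eq_of_mem _ _ _ half_pos.le
  have h1 : γ 1 = z := by
    rw [← hγ₂1]; exact piecewise_eq_of_notMem _ _ _ (notMem_Iic.2 half_lt)
  refine (pathEDistIn_le_of_path hγ.contMDiffOn hγT h0 h1).trans_lt (lt_trans ?_ huv)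
  rw [← pathELength_add half_pos.le half_lt.le]
  refine ENNReal.add_lt_add ?_ ?_
  · convert! hγ₁u using 1
    refine pathELength_congr fun t ht => piecewise_eq_of_mem _ _ _ ht.2
  · convert! hγ₂v using 1
    refine pathELength_congr_Ioo fun t ht => piecewise_eq_of_notMem _ _ _ (notMem_Iic.2 ht.1)

end PathEDistIn

/-! ### Transversals of good charts -/

section Transversal

open Manifold
open scoped NNReal

lemma convex_openCube (n : ℕ) (r : ℝ) : Convex ℝ (openCube n r) :=
  convex_pi fun _ _ => convex_Ioo _ _

lemma zero_mem_openCube {n : ℕ} {r : ℝ} (hr : 0 < r) : (0 : Fin n → ℝ) ∈ openCube n r :=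
  fun _ _ => ⟨neg_neg_iff_pos.2 hr, hr⟩

variable {p q : ℕ} {M : Type*} [TopologicalSpace M]
  [ChartedSpace (EuclideanSpace ℝ (Fin (p + q))) M]
  {φ ψ : OpenPartialHomeomorph M ((Fin p → ℝ) × (Fin q → ℝ))}

lemma IsBoxChart.contMDiffAt (hψ : IsBoxChart ψ) {x : M} (hx : x ∈ ψ.source) :
    ContMDiffAt (𝓡 (p + q)) 𝓘(ℝ, (Fin p → ℝ) × (Fin q → ℝ)) 1 ψ x :=
  hψ.contMDiffOn.contMDiffAt (ψ.open_source.mem_nhds hx)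

lemma IsBoxChart.contMDiffAt_symm (hψ : IsBoxChart ψ) {y : (Fin p → ℝ) × (Fin q → ℝ)}
    (hy : y ∈ ψ.target) :
    ContMDiffAt 𝓘(ℝ, (Fin p → ℝ) × (Fin q → ℝ)) (𝓡 (p + q)) 1 ψ.symm y :=
  hψ.contMDiffOn_symm.contMDiffAt (ψ.open_target.mem_nhds hy)

variable [RiemannianBundle (fun x : M => TangentSpace (𝓡 (p + q)) x)]
  [IsManifold (𝓡 (p + q)) 1 M]
  [IsContinuousRiemannianBundle (EuclideanSpace ℝ (Fin (p + q)))
    (fun x : M => TangentSpace (𝓡 (p + q)) x)]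

/-- If a chart extends to a neighbourhood of the compact closure of its domain, then the path-length
distance on its transversal is uniformly comparable with the distance of the coordinates. -/
lemma exists_pathEDistIn_transversal_comparison
    (hφ : φ.target = openCube p 1 ×ˢ openCube q 1) (hc : IsCompact (closure φ.source))
    (hψ : IsBoxChart ψ) (hsub : closure φ.source ⊆ ψ.source) (heq : EqOn φ ψ φ.source) :
    ∃ C : ℝ≥0, ∀ u ∈ openCube q 1, ∀ v ∈ openCube q 1,
      edist u v ≤ C * pathEDistIn (p := p) (q := q) (transversal φ) (φ.symm (0, u))
        (φ.symm (0, v)) ∧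
      pathEDistIn (p := p) (q := q) (transversal φ) (φ.symm (0, u)) (φ.symm (0, v)) ≤
        C * edist u v := by
  have hzero : ∀ u ∈ openCube q 1, ((0 : Fin p → ℝ), u) ∈ φ.target := fun u hu => by
    rw [hφ]; exact ⟨zero_mem_openCube one_pos, hu⟩
  have hsymm : ∀ y ∈ φ.target, ψ.symm y = φ.symm y := fun y hy => by
    have hy' := φ.map_target hy
    rw [← ψ.left_inv (hsub (subset_closure hy')), ← heq hy', φ.right_inv hy]
  have htarget : φ.target ⊆ ψ '' closure φ.source := fun y hy =>
    ⟨φ.symm y, subset_closure (φ.map_target hy), by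
      rw [← heq (φ.map_target hy), φ.right_inv hy]⟩
  have hsnd : ∀ x ∈ closure φ.source,
      ContMDiffAt (𝓡 (p + q)) 𝓘(ℝ, Fin q → ℝ) 1 (fun x => (ψ x).2) x := fun x hx =>
    (contDiff_snd.contDiffAt.contMDiffAt).comp x (hψ.contMDiffAt (hsub hx))
  obtain ⟨C, hC⟩ := hc.exists_enorm_deriv_comp_le hsnd
  have hK : IsCompact (ψ '' closure φ.source) :=
    hc.image_of_continuousOn (ψ.continuousOn.mono hsub)
  have hKψ : ∀ y ∈ ψ '' closure φ.source, y ∈ ψ.target := by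
    rintro _ ⟨x, hx, rfl⟩
    exact ψ.map_source (hsub hx)
  obtain ⟨D, hD⟩ := hK.exists_enorm_mfderiv_comp_le
    fun y hy => hψ.contMDiffAt_symm (hKψ y hy)
  have hCE : (C : ℝ≥0∞) ≤ ↑(max C D + 1) :=
    ENNReal.coe_le_coe.2 ((le_max_left C D).trans le_self_add)
  have hDE : (D : ℝ≥0∞) ≤ ↑(max C D + 1) :=
    ENNReal.coe_le_coe.2 ((le_max_right C D).trans le_self_add)
  -- The constant is made nonzero in order to divide by it.
  refine ⟨max C D + 1, fun u hu v hv => ⟨?_, ?_⟩⟩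
  · rw [mul_comm, ← ENNReal.div_le_iff_le_mul (Or.inl (by simp)) (Or.inl ENNReal.coe_ne_top)]
    refine le_iInf₂ fun γ ⟨hγ, hT, h0, h1⟩ => ENNReal.div_le_of_le_mul' ?_
    have hγK : MapsTo γ (Icc 0 1) (closure φ.source) := fun t ht => by
      obtain ⟨y, ⟨hy0, hy⟩, hyt⟩ := hT ht
      have hy' : y ∈ φ.target := by
        rw [hφ]; exact ⟨hy0 ▸ zero_mem_openCube one_pos, hy⟩
      rw [← hyt]
      exact subset_closure (φ.map_target hy')
    have hsnd' : ∀ w ∈ openCube q 1, (ψ (φ.symm (0, w))).2 = w := fun w hw => by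
      rw [← heq (φ.map_target (hzero w hw)), φ.right_inv (hzero w hw)]
    have hlen := enorm_sub_le_mul_pathELength hsnd hC hγ hγK
    rw [h0, h1, hsnd' u hu, hsnd' v hv, ← edist_eq_enorm_sub, edist_comm] at hlen
    exact hlen.trans (mul_le_mul_left hCE _)
  -- For the upper bound, the image of the segment between the coordinates is a path in `T`.
  · have hseg : segment ℝ ((0 : Fin p → ℝ), u) (0, v) ⊆ φ.target := by
      refine Convex.segment_subset ?_ (hzero u hu) (hzero v hv)
      rw [hφ]
      exact (convex_openCube p 1).prod (convex_openCube q 1)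
    have hline : MapsTo (AffineMap.lineMap ((0 : Fin p → ℝ), u) ((0 : Fin p → ℝ), v) : ℝ → _)
        (Icc (0 : ℝ) 1) φ.target := fun t ht => hseg (by
      rw [segment_eq_image_lineMap]; exact mem_image_of_mem _ ht)
    have hlen := pathELength_comp_lineMap_le hD (hseg.trans htarget)
    refine (pathEDistIn_le_of_path (γ := ψ.symm ∘ AffineMap.lineMap (0, u) (0, v)) ?_ ?_ ?_
      ?_).trans (hlen.trans ?_)
    · refine hψ.contMDiffOn_symm.comp ?_ fun t ht => hKψ _ (htarget (hline ht))
      rw [contMDiffOn_iff_contDiffOn]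
      exact (ContinuousAffineMap.lineMap (R := ℝ) ((0 : Fin p → ℝ), u) (0, v)).contDiff.contDiffOn
    · intro t ht
      refine ⟨AffineMap.lineMap (0, u) (0, v) t, ⟨?_, ?_⟩, (hsymm _ (hline ht)).symm⟩
      · simp [AffineMap.lineMap_apply]
      · have := hline ht
        rw [hφ] at this
        exact this.2
    · simpa using hsymm _ (hzero u hu)
    · simpa using hsymm _ (hzero v hv)
    · have : ‖((0 : Fin p → ℝ), v) - (0, u)‖ₑ = edist u v := by
        rw [← edist_eq_enorm_sub, edist_comm, Prod.edist_eq]; simp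
      rw [this]
      exact mul_le_mul_left hDE _

end Transversal

/-! ### Lipschitz domination along a filter -/

section LipDominates

open scoped NNReal

variable {X Y G G' G'' : Type*} [PseudoEMetricSpace G] [PseudoEMetricSpace G']
  [PseudoEMetricSpace G''] {l : Filter X} {κ : X → G} {κ' : X → G'} {κ'' : X → G''}

/-- Along the filter `l`, the map `κ'` is a Lipschitz function of `κ`: the distances of its values
are at most a constant times the distances of the values of `κ`. -/
def LipDominates (l : Filter X) (κ : X → G) (κ' : X → G') : Prop :=
  ∃ C : ℝ≥0, ∀ᶠ P in l ×ˢ l, edist (κ' P.1) (κ' P.2) ≤ C * edist (κ P.1) (κ P.2)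

lemma LipDominates.trans (h : LipDominates l κ κ') (h' : LipDominates l κ' κ'') :
    LipDominates l κ κ'' := by
  obtain ⟨C, hC⟩ := h
  obtain ⟨D, hD⟩ := h'
  refine ⟨D * C, ?_⟩
  filter_upwards [hC, hD] with P h1 h2
  rw [ENNReal.coe_mul, mul_assoc]
  exact h2.trans (mul_le_mul_right h1 _)

lemma LipDominates.of_eventuallyEq {κ₁ : X → G} (h : κ =ᶠ[l] κ₁) : LipDominates l κ κ₁ := by
  refine ⟨1, ?_⟩
  filter_upwards [Filter.Eventually.prod_mk h h] with P hP
  simp [hP.1, hP.2]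

lemma LipDominates.comp (h : LipDominates l κ κ') {l' : Filter Y} {g : Y → X}
    (hg : Tendsto g l' l) : LipDominates l' (κ ∘ g) (κ' ∘ g) := by
  obtain ⟨C, hC⟩ := h
  exact ⟨C, (hg.prodMap hg).eventually hC⟩

end LipDominates

/-! ### Transverse coordinates of the foliation -/

section ChartChange

variable {p q : ℕ} {M : Type*} [TopologicalSpace M]
  [ChartedSpace (EuclideanSpace ℝ (Fin (p + q))) M]
  {φ ψ : OpenPartialHomeomorph M ((Fin p → ℝ) × (Fin q → ℝ))}

/-- Compatibility with plaques makes the transverse coordinate of one chart a `C¹`, hence locally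
Lipschitz, function of the transverse coordinate of the other. -/
lemma PlaqueCompatible.lipDominates (h : PlaqueCompatible φ ψ) (hφ : IsBoxChart φ)
    (hψ : IsBoxChart ψ) {x : M} (hxφ : x ∈ φ.source) (hxψ : x ∈ ψ.source) :
    LipDominates (𝓝 x) (fun z => (φ z).2) (fun z => (ψ z).2) := by
  -- Near `x`, the coordinate `(ψ z).2` equals its value at the point with the same `(φ z).2` on the
  -- transversal of `φ` through `x`.
  obtain ⟨U, hU, hUc⟩ := h x ⟨hxφ, hxψ⟩
  let c : (Fin q → ℝ) → (Fin p → ℝ) × (Fin q → ℝ) := fun u => ((φ x).1, u)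
  have hc : c (φ x).2 = φ x := rfl
  have hcd : ContDiff ℝ 1 c := by fun_prop
  have hσ : ContMDiffAt 𝓘(ℝ, Fin q → ℝ) (𝓡 (p + q)) 1 (fun u => φ.symm (c u)) (φ x).2 :=
    (hφ.contMDiffAt_symm (φ.map_source hxφ)).comp (φ x).2 hcd.contDiffAt.contMDiffAt
  have hσx : φ.symm (c (φ x).2) = x := φ.left_inv hxφ
  have hG : ContDiffAt ℝ 1 (fun u => (ψ (φ.symm (c u))).2) (φ x).2 := by
    have h1 : ContMDiffAt 𝓘(ℝ, Fin q → ℝ) 𝓘(ℝ, (Fin p → ℝ) × (Fin q → ℝ)) 1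
        (fun u => ψ (φ.symm (c u))) (φ x).2 :=
      ContMDiffAt.comp (g := ψ) (φ x).2 (by rw [hσx]; exact hψ.contMDiffAt hxψ) hσ
    exact contDiff_snd.contDiffAt.comp (φ x).2 h1.contDiffAt
  obtain ⟨C, t, ht, hC⟩ := hG.exists_lipschitzOnWith
  have hφ2 : ContinuousAt (fun z => (φ z).2) x :=
    continuous_snd.continuousAt.comp (φ.continuousAt hxφ)
  have hev : ∀ᶠ z in 𝓝 x, (φ z).2 ∈ t ∧ (ψ z).2 = (ψ (φ.symm (c (φ z).2))).2 := by
    have h1 : ∀ᶠ u in 𝓝 (φ x).2, φ.symm (c u) ∈ U ∧ c u ∈ φ.target := by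
      refine (hσ.continuousAt.eventually_mem (by rwa [hσx])).and ?_
      exact hcd.continuous.continuousAt.eventually_mem
        (φ.open_target.mem_nhds (φ.map_source hxφ))
    filter_upwards [hφ2.eventually_mem ht, hφ2.eventually h1, hU] with z hz hz' hzU
    refine ⟨hz, hUc z hzU _ hz'.1 ?_⟩
    rw [φ.right_inv hz'.2]
  refine ⟨C, ?_⟩
  filter_upwards [hev.prod_mk hev] with P hP
  rw [hP.1.2, hP.2.2]
  exact hC hP.1.1 hP.2.1

end ChartChange

/-! ### Plaques of the matchbox manifold and plaques of the foliation -/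

section Plaques

variable {n p q : ℕ} {𝔐 X M : Type*} [TopologicalSpace 𝔐] [TopologicalSpace X] [TopologicalSpace M]
  {Z : Set M} {f : 𝔐 → M}

/-- A continuous map into a set with totally disconnected transverse trace maps small plaques of a
matchbox chart into plaques of the foliation chart. -/
lemma MatchboxChart.exists_nhds_transverse_eq (φ : MatchboxChart n 𝔐 X) (hf : Continuous f)
    (hfZ : ∀ z, f z ∈ Z) {ψ : OpenPartialHomeomorph M ((Fin p → ℝ) × (Fin q → ℝ))}
    (hψ : IsTotallyDisconnected ((fun x => (ψ x).2) '' (Z ∩ ψ.source)))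
    {y : Fin n → ℝ} {w : X} (hyw : (y, w) ∈ φ.toChart.target)
    (hfy : f (φ.toChart.symm (y, w)) ∈ ψ.source) :
    ∃ A ∈ 𝓝 y, ∃ B ∈ 𝓝 w, ∀ y' ∈ A, ∀ w' ∈ B, (y', w') ∈ φ.toChart.target ∧
      f (φ.toChart.symm (y', w')) ∈ ψ.source ∧
      (ψ (f (φ.toChart.symm (y', w')))).2 = (ψ (f (φ.toChart.symm (y, w')))).2 := by
  have h1 : ∀ᶠ v in 𝓝 (y, w), v ∈ φ.toChart.target ∧ f (φ.toChart.symm v) ∈ ψ.source := by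
    refine (φ.toChart.open_target.eventually_mem hyw).and ?_
    exact (hf.continuousAt.comp (φ.toChart.continuousAt_symm hyw)).eventually_mem
      (ψ.open_source.mem_nhds hfy)
  rw [nhds_prod_eq, eventually_prod_iff] at h1
  obtain ⟨a, ha, b, hb, hab⟩ := h1
  obtain ⟨r, hr, hra⟩ := Metric.eventually_nhds_iff_ball.1 ha
  refine ⟨Metric.ball y r, Metric.ball_mem_nhds y hr, {w' | b w'}, hb, fun y' hy' w' hw' => ?_⟩
  refine ⟨(hab (hra y' hy') hw').1, (hab (hra y' hy') hw').2, ?_⟩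
  have hcont : ContinuousOn (fun y' => (ψ (f (φ.toChart.symm (y', w')))).2) (Metric.ball y r) := by
    intro v hv
    have hv' := hab (hra v hv) hw'
    have h2 : ContinuousAt (fun v => φ.toChart.symm (v, w')) v :=
      (φ.toChart.continuousAt_symm hv'.1).comp (f := fun v => (v, w')) (by fun_prop)
    have h3 : ContinuousAt (fun v => ψ (f (φ.toChart.symm (v, w')))) v :=
      ContinuousAt.comp (g := ψ) (ψ.continuousAt hv'.2) (hf.continuousAt.comp h2)
    exact (continuous_snd.continuousAt.comp h3).continuousWithinAt
  refine hψ ((fun y' => (ψ (f (φ.toChart.symm (y', w')))).2) '' Metric.ball y r) ?_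
    (((convex_ball y r).isPreconnected).image _ hcont) (mem_image_of_mem _ hy')
    (mem_image_of_mem _ (Metric.mem_ball_self hr))
  rintro _ ⟨v, hv, rfl⟩
  exact ⟨_, ⟨hfZ _, (hab (hra v hv) hw').2⟩, rfl⟩

variable [ChartedSpace (EuclideanSpace ℝ (Fin (p + q))) M] {F : C1Foliation p q M}

/-- Holonomy along the plaque of a matchbox chart: the transverse coordinates of the images of two
points that move over the transversal in parallel are Lipschitz functions of each other. -/
lemma MatchboxChart.lipDominates_plaque (φ : MatchboxChart n 𝔐 X) (hf : Continuous f)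
    (hfZ : ∀ z, f z ∈ Z)
    (hdisc : ∀ ψ ∈ F.charts, IsTotallyDisconnected ((fun x => (ψ x).2) '' (Z ∩ ψ.source)))
    {w : X} (hw : w ∈ φ.model) {y y' : Fin n → ℝ} (hy : y ∈ openCube n 2) (hy' : y' ∈ openCube n 2)
    {ψ ψ' : OpenPartialHomeomorph M ((Fin p → ℝ) × (Fin q → ℝ))} (hψ : ψ ∈ F.charts)
    (hψ' : ψ' ∈ F.charts) (hfy : f (φ.toChart.symm (y, w)) ∈ ψ.source)
    (hfy' : f (φ.toChart.symm (y', w)) ∈ ψ'.source) :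
    LipDominates (𝓝 w) (fun w' => (ψ (f (φ.toChart.symm (y, w')))).2)
      (fun w' => (ψ' (f (φ.toChart.symm (y', w')))).2) := by
  have htarget : ∀ {y}, y ∈ openCube n 2 → (y, w) ∈ φ.toChart.target := fun hy => by
    rw [φ.target_eq]; exact ⟨hy, hw⟩
  have change : ∀ {y}, y ∈ openCube n 2 → ∀ ψ ∈ F.charts, ∀ ψ' ∈ F.charts,
      f (φ.toChart.symm (y, w)) ∈ ψ.source → f (φ.toChart.symm (y, w)) ∈ ψ'.source →
      LipDominates (𝓝 w) (fun w' => (ψ (f (φ.toChart.symm (y, w')))).2)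
        (fun w' => (ψ' (f (φ.toChart.symm (y, w')))).2) := by
    intro y hy ψ hψ ψ' hψ' h h'
    have hc : ContinuousAt (fun w' => f (φ.toChart.symm (y, w'))) w :=
      hf.continuousAt.comp ((φ.toChart.continuousAt_symm (htarget hy)).comp
        (f := fun w' => (y, w')) (by fun_prop))
    exact ((F.compatible ψ hψ ψ' hψ').lipDominates (F.isBoxChart ψ hψ) (F.isBoxChart ψ' hψ')
      h h').comp hc
  have hconn : IsPreconnected (openCube n 2) := (convex_openCube n 2).isPreconnected
  refine hconn.induction₂' (fun y y' => ∀ ψ ∈ F.charts, ∀ ψ' ∈ F.charts,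
      f (φ.toChart.symm (y, w)) ∈ ψ.source → f (φ.toChart.symm (y', w)) ∈ ψ'.source →
      LipDominates (𝓝 w) (fun w' => (ψ (f (φ.toChart.symm (y, w')))).2)
        (fun w' => (ψ' (f (φ.toChart.symm (y', w')))).2)) ?_ ?_ hy hy' ψ hψ ψ' hψ' hfy hfy'
  · intro y hy
    obtain ⟨ψ₀, hψ₀, hfy₀⟩ := F.cover (f (φ.toChart.symm (y, w)))
    obtain ⟨A, hA, B, hB, hAB⟩ := φ.exists_nhds_transverse_eq hf hfZ (hdisc ψ₀ hψ₀) (htarget hy)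
      hfy₀
    filter_upwards [mem_nhdsWithin_of_mem_nhds hA, self_mem_nhdsWithin] with y' hy'A hy'
    have hfy'₀ := (hAB y' hy'A w (mem_of_mem_nhds hB)).2.1
    have heq : (fun w' => (ψ₀ (f (φ.toChart.symm (y, w')))).2) =ᶠ[𝓝 w]
        fun w' => (ψ₀ (f (φ.toChart.symm (y', w')))).2 := by
      filter_upwards [hB] with w' hw' using (hAB y' hy'A w' hw').2.2.symm
    refine ⟨fun ψ hψ ψ' hψ' h h' => ?_, fun ψ hψ ψ' hψ' h h' => ?_⟩
    · exact ((change hy ψ hψ ψ₀ hψ₀ h hfy₀).trans (.of_eventuallyEq heq)).trans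
        (change hy' ψ₀ hψ₀ ψ' hψ' hfy'₀ h')
    · exact ((change hy' ψ hψ ψ₀ hψ₀ h hfy'₀).trans (.of_eventuallyEq heq.symm)).trans
        (change hy ψ₀ hψ₀ ψ' hψ' hfy₀ h')
  · intro y₁ y₂ y₃ _ _ _ h12 h23 ψ hψ ψ' hψ' h h'
    obtain ⟨ψ₀, hψ₀, h₀⟩ := F.cover (f (φ.toChart.symm (y₂, w)))
    exact (h12 ψ hψ ψ₀ hψ₀ h h₀).trans (h23 ψ₀ hψ₀ ψ' hψ' h₀ h')

lemma MatchboxChart.zero_mem_target (φ : MatchboxChart n 𝔐 X) {w : X} (hw : w ∈ φ.model) :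
    ((0 : Fin n → ℝ), w) ∈ φ.toChart.target := by
  rw [φ.target_eq]; exact ⟨zero_mem_openCube two_pos, hw⟩

lemma MatchboxChart.continuousAt_sec (φ : MatchboxChart n 𝔐 X) {w : X} (hw : w ∈ φ.model) :
    ContinuousAt φ.sec w :=
  (φ.toChart.continuousAt_symm (φ.zero_mem_target hw)).comp (f := fun w' => (0, w')) (by fun_prop)

lemma MatchboxChart.sec_mem_source (φ : MatchboxChart n 𝔐 X) {w : X} (hw : w ∈ φ.model) :
    φ.sec w ∈ φ.toChart.source :=
  φ.toChart.map_target (φ.zero_mem_target hw)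

lemma MatchboxChart.proj_sec (φ : MatchboxChart n 𝔐 X) {w : X} (hw : w ∈ φ.model) :
    φ.proj (φ.sec w) = w := by
  simp only [MatchboxChart.proj, MatchboxChart.sec]
  rw [φ.toChart.right_inv (φ.zero_mem_target hw)]

namespace RegularCovering

variable {ν : ℕ} {S : MatchboxManifold n 𝔐 X}

/-- The holonomy map `hᵢⱼ` is the germ of a Lipschitz map in the transverse coordinates of the
foliation: one moves along a plaque of the `i`-th chart from the section to the overlap, and from
there along a plaque of the `j`-th chart. -/
lemma lipDominates_holonomyFun_charts (R : RegularCovering S ν) (hf : Continuous f)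
    (hfZ : ∀ z, f z ∈ Z)
    (hdisc : ∀ ψ ∈ F.charts, IsTotallyDisconnected ((fun x => (ψ x).2) '' (Z ∩ ψ.source)))
    (i j : Fin ν) {w : X} (hw : w ∈ R.overlapProj i j)
    {ψ ψ' : OpenPartialHomeomorph M ((Fin p → ℝ) × (Fin q → ℝ))} (hψ : ψ ∈ F.charts)
    (hψ' : ψ' ∈ F.charts) (h : f ((R.chart i).sec w) ∈ ψ.source)
    (h' : f ((R.chart j).sec (R.holonomyFun i j w)) ∈ ψ'.source) :
    LipDominates (𝓝 w) (fun w' => (ψ (f ((R.chart i).sec w'))).2)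
      (fun w' => (ψ' (f ((R.chart j).sec (R.holonomyFun i j w')))).2) := by
  have hcont : ContinuousAt (R.holonomyFun i j) w :=
    (R.continuousOn_holonomyFun i j).continuousAt ((R.isOpen_overlapProj i j).mem_nhds hw)
  obtain ⟨z, hz, rfl⟩ := hw
  have hzi : z ∈ (R.chart i).toChart.source := (R.chart i).dom_subset hz.1
  have hzj : z ∈ (R.chart j).toChart.source := (R.chart j).dom_subset hz.2
  have hhol := R.holonomyFun_proj i j hz
  obtain ⟨ψ₀, hψ₀, h₀⟩ := F.cover (f z)
  have hi : (R.chart i).toChart.symm (((R.chart i).toChart z).1, (R.chart i).proj z) = z :=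
    (R.chart i).toChart.left_inv hzi
  have hj : (R.chart j).toChart.symm (((R.chart j).toChart z).1, (R.chart j).proj z) = z :=
    (R.chart j).toChart.left_inv hzj
  have dom1 := (R.chart i).lipDominates_plaque hf hfZ hdisc ((R.chart i).proj_mem_model hz.1)
    (zero_mem_openCube two_pos) (openCube_one_subset_two n hz.1.2.1) hψ hψ₀ h (by rwa [hi])
  have dom2 := (R.chart j).lipDominates_plaque hf hfZ hdisc ((R.chart j).proj_mem_model hz.2)
    (openCube_one_subset_two n hz.2.2.1) (zero_mem_openCube two_pos) hψ₀ hψ' (by rwa [hj])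
    (by rw [← hhol]; exact h')
  have hlim : Tendsto (R.holonomyFun i j) (𝓝 ((R.chart i).proj z)) (𝓝 ((R.chart j).proj z)) := by
    rw [← hhol]; exact hcont
  -- The point of the `i`-th transversal through `z` over `w'` lies on the plaque of the `j`-th chart
  -- over `hᵢⱼ(w')`, close to the point of the `j`-th transversal through `z` on this plaque.
  refine (dom1.trans (.of_eventuallyEq ?_)).trans (dom2.comp hlim)
  obtain ⟨A, hA, B, hB, hAB⟩ := (R.chart j).exists_nhds_transverse_eq hf hfZ (hdisc ψ₀ hψ₀)
    (y := ((R.chart j).toChart z).1) (w := (R.chart j).proj z)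
    ((R.chart j).toChart.map_source hzj) (by rwa [hj])
  have hm : ContinuousAt (fun w' => (R.chart i).toChart.symm (((R.chart i).toChart z).1, w'))
      ((R.chart i).proj z) :=
    ((R.chart i).toChart.continuousAt_symm ((R.chart i).toChart.map_source hzi)).comp
      (f := fun w' => (((R.chart i).toChart z).1, w')) (by fun_prop)
  have hm1 := hm.eventually_mem (by rw [hi]; exact (R.isOpen_overlap i j).mem_nhds hz)
  have hm2 : ∀ᶠ w' in 𝓝 ((R.chart i).proj z), ((R.chart j).toChart
      ((R.chart i).toChart.symm (((R.chart i).toChart z).1, w'))) ∈ A ×ˢ B := by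
    refine (ContinuousAt.comp (g := (R.chart j).toChart) ?_ hm).eventually_mem ?_
    · rw [hi]; exact (R.chart j).toChart.continuousAt hzj
    · rw [Function.comp_apply, hi]; exact prod_mem_nhds hA hB
  have hm3 : ∀ᶠ w' in 𝓝 ((R.chart i).proj z),
      (((R.chart i).toChart z).1, w') ∈ (R.chart i).toChart.target := by
    have hc : ContinuousAt (fun w' => (((R.chart i).toChart z).1, w')) ((R.chart i).proj z) := by
      fun_prop
    exact hc.eventually_mem
      ((R.chart i).toChart.open_target.mem_nhds ((R.chart i).toChart.map_source hzi))
  filter_upwards [hm1, hm2, hm3] with w' h1 h2 h3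
  have h4 : (R.chart i).proj ((R.chart i).toChart.symm (((R.chart i).toChart z).1, w')) = w' := by
    simp only [MatchboxChart.proj]
    rw [(R.chart i).toChart.right_inv h3]
  have h5 := R.holonomyFun_proj i j h1
  rw [h4] at h5
  have h6 := (hAB _ h2.1 _ h2.2).2.2
  rw [Prod.mk.eta, (R.chart j).toChart.left_inv ((R.chart j).dom_subset h1.2)] at h6
  rw [h6, Function.comp_apply, h5]
  rfl

/-- The conclusion of `lipDominates_holonomyFun_charts` for all foliation charts. -/
lemma lipDominates_holonomyFun (R : RegularCovering S ν) (hf : Continuous f) (hfZ : ∀ z, f z ∈ Z)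
    (hdisc : ∀ ψ ∈ F.charts, IsTotallyDisconnected ((fun x => (ψ x).2) '' (Z ∩ ψ.source)))
    (i j : Fin ν) {w : X} (hw : w ∈ R.overlapProj i j)
    {ψ ψ' : OpenPartialHomeomorph M ((Fin p → ℝ) × (Fin q → ℝ))} (hψ : F.IsChart ψ)
    (hψ' : F.IsChart ψ') (h : f ((R.chart i).sec w) ∈ ψ.source)
    (h' : f ((R.chart j).sec (R.holonomyFun i j w)) ∈ ψ'.source) :
    LipDominates (𝓝 w) (fun w' => (ψ (f ((R.chart i).sec w'))).2)
      (fun w' => (ψ' (f ((R.chart j).sec (R.holonomyFun i j w')))).2) := by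
  have hcont : ContinuousAt (R.holonomyFun i j) w :=
    (R.continuousOn_holonomyFun i j).continuousAt ((R.isOpen_overlapProj i j).mem_nhds hw)
  have hw' : R.holonomyFun i j w ∈ (R.chart j).model := by
    obtain ⟨z, hz, rfl⟩ := hw
    rw [R.holonomyFun_proj i j hz]
    exact (R.chart j).proj_mem_model hz.2
  have hwi : w ∈ (R.chart i).model := by
    obtain ⟨z, hz, rfl⟩ := hw
    exact (R.chart i).proj_mem_model hz.1
  obtain ⟨ψ₁, hψ₁, h₁⟩ := F.cover (f ((R.chart i).sec w))
  obtain ⟨ψ₂, hψ₂, h₂⟩ := F.cover (f ((R.chart j).sec (R.holonomyFun i j w)))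
  have dom1 := ((hψ.2 ψ₁ hψ₁).1.lipDominates hψ.1 (F.isBoxChart ψ₁ hψ₁) h h₁).comp
    (hf.continuousAt.comp ((R.chart i).continuousAt_sec hwi))
  have dom2 := ((hψ'.2 ψ₂ hψ₂).2.lipDominates (F.isBoxChart ψ₂ hψ₂) hψ'.1 h₂ h').comp
    (hf.continuousAt.comp ((R.chart j).continuousAt_sec hw'))
  exact (dom1.trans (R.lipDominates_holonomyFun_charts hf hfZ hdisc i j hw hψ₁ hψ₂ h₁ h₂)).trans
    (dom2.comp hcont)

end RegularCovering

/-- The transverse coordinate is locally injective on the section of a matchbox chart. Since `Z` is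
saturated, it contains the small plaques of the foliation through its points; these are connected,
so `f⁻¹` maps each of them into a single plaque of the matchbox chart. -/
lemma MatchboxChart.exists_nhds_injOn_transverse [TotallyDisconnectedSpace X]
    (φ : MatchboxChart n 𝔐 X) (f : 𝔐 ≃ₜ Z) (hZ : F.IsSaturated Z)
    {ψ : OpenPartialHomeomorph M ((Fin p → ℝ) × (Fin q → ℝ))} (hψ : F.IsChart ψ) {w : X}
    (hw : w ∈ φ.model) (hx : (f (φ.sec w) : M) ∈ ψ.source) :
    ∃ N ∈ 𝓝 w, InjOn (fun w' => (ψ (f (φ.sec w'))).2) N := by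
  obtain ⟨ψ₀, hψ₀, h₀⟩ := F.cover (f (φ.sec w) : M)
  obtain ⟨U, hU, hUc⟩ := (hψ.2 ψ₀ hψ₀).1 _ ⟨hx, h₀⟩
  have hO : IsOpen (f.symm ⁻¹' φ.toChart.source) :=
    φ.toChart.open_source.preimage f.symm.continuous
  obtain ⟨O, hOo, hO⟩ := isOpen_induced_iff.1 hO
  have hxO : (f (φ.sec w) : M) ∈ O := by
    have : f (φ.sec w) ∈ f.symm ⁻¹' φ.toChart.source := by
      rw [mem_preimage, f.symm_apply_apply]; exact φ.sec_mem_source hw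
    rwa [← hO] at this
  have hbox : ∀ᶠ v in 𝓝 (ψ₀ (f (φ.sec w))), v ∈ ψ₀.target ∧ ψ₀.symm v ∈ O := by
    refine (ψ₀.open_target.eventually_mem (ψ₀.map_source h₀)).and ?_
    refine (ψ₀.continuousAt_symm (ψ₀.map_source h₀)).eventually_mem ?_
    rw [ψ₀.left_inv h₀]
    exact hOo.mem_nhds hxO
  obtain ⟨v₀, hv₀⟩ : ∃ v, v = ψ₀ (f (φ.sec w)) := ⟨_, rfl⟩
  rw [← hv₀] at hbox
  obtain ⟨a₀, b₀⟩ := v₀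
  rw [nhds_prod_eq, eventually_prod_iff] at hbox
  obtain ⟨P, hP, B, hB, hPB⟩ := hbox
  obtain ⟨r, hr, hrP⟩ := Metric.eventually_nhds_iff_ball.1 hP
  -- Points of `Z` on the same small plaque of `F` correspond to points on the same plaque of `φ`.
  have hplaque : ∀ x x' : Z, (x : M) ∈ ψ₀.source → (x' : M) ∈ ψ₀.source →
      (ψ₀ x).1 ∈ Metric.ball a₀ r → (ψ₀ x').1 ∈ Metric.ball a₀ r → B (ψ₀ x).2 →
      (ψ₀ x).2 = (ψ₀ x').2 → φ.proj (f.symm x) = φ.proj (f.symm x') := by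
    intro x x' hx hx' ha ha' hb hbb'
    let s : (Fin p → ℝ) → M := fun a => ψ₀.symm (a, (ψ₀ x).2)
    have hs : ContinuousOn s (Metric.ball a₀ r) := fun a ha => by
      have hc : ContinuousAt (fun a => (a, (ψ₀ x).2)) a := by fun_prop
      exact ((ψ₀.continuousAt_symm (hPB (hrP a ha) hb).1).comp
        (f := fun a => (a, (ψ₀ x).2)) hc).continuousWithinAt
    have hsZ : s '' Metric.ball a₀ r ⊆ Z := by
      rintro _ ⟨a, ha, rfl⟩
      have ht := (hPB (hrP a ha) hb).1
      refine hZ x x.2 (Relation.EqvGen.rel _ _ ⟨ψ₀, hψ₀, hx, ψ₀.map_target ht, ?_⟩)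
      rw [ψ₀.right_inv ht]
    have hpre : IsPreconnected ((Subtype.val : Z → M) ⁻¹' (s '' Metric.ball a₀ r)) := by
      rw [← Topology.IsInducing.subtypeVal.isPreconnected_image, Subtype.image_preimage_coe,
        inter_eq_right.2 hsZ]
      exact (convex_ball a₀ r).isPreconnected.image _ hs
    have hpre' := hpre.image f.symm f.symm.continuous.continuousOn
    have hsub : f.symm '' ((Subtype.val : Z → M) ⁻¹' (s '' Metric.ball a₀ r)) ⊆
        φ.toChart.source := by
      rintro _ ⟨x'', ⟨a, ha, hax⟩, rfl⟩
      have : x'' ∈ (Subtype.val : Z → M) ⁻¹' O := by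
        rw [mem_preimage, ← hax]; exact (hPB (hrP a ha) hb).2
      rwa [hO] at this
    have hproj : ContinuousOn φ.proj φ.toChart.source :=
      continuous_snd.comp_continuousOn φ.toChart.continuousOn
    refine (hpre'.image φ.proj (hproj.mono hsub)).subsingleton ?_ ?_
    · refine mem_image_of_mem _ (mem_image_of_mem _ ⟨(ψ₀ x).1, ha, ?_⟩)
      exact ψ₀.left_inv hx
    · refine mem_image_of_mem _ (mem_image_of_mem _ ⟨(ψ₀ x').1, ha', ?_⟩)
      simp only [s]
      rw [hbb']
      exact ψ₀.left_inv hx'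
  have hsec : ContinuousAt (fun w' => (f (φ.sec w') : M)) w :=
    (continuous_subtype_val.comp f.continuous).continuousAt.comp (φ.continuousAt_sec hw)
  have hψsec : ContinuousAt (fun w' => ψ₀ (f (φ.sec w'))) w :=
    ContinuousAt.comp (g := ψ₀) (ψ₀.continuousAt h₀) hsec
  have hN : ∀ᶠ w' in 𝓝 w, w' ∈ φ.model ∧ (f (φ.sec w') : M) ∈ U ∧
      (f (φ.sec w') : M) ∈ ψ₀.source ∧ (ψ₀ (f (φ.sec w'))).1 ∈ Metric.ball a₀ r ∧
      B (ψ₀ (f (φ.sec w'))).2 := by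
    refine (φ.isClopen_model.isOpen.eventually_mem hw).and ((hsec.eventually_mem hU).and
      ((hsec.eventually_mem (ψ₀.open_source.mem_nhds h₀)).and ?_))
    refine ((continuous_fst.continuousAt.comp hψsec).eventually_mem ?_).and
      ((continuous_snd.continuousAt.comp hψsec).eventually ?_)
    · rw [Function.comp_apply, ← hv₀]; exact Metric.ball_mem_nhds _ hr
    · rw [Function.comp_apply, ← hv₀]; exact hB
  refine ⟨_, hN, ?_⟩
  rintro w₁ ⟨hm₁, hU₁, hs₁, ha₁, hb₁⟩ w₂ ⟨hm₂, hU₂, hs₂, ha₂, hb₂⟩ h12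
  have := hplaque _ _ hs₁ hs₂ ha₁ ha₂ hb₁ (hUc _ hU₁ _ hU₂ h12)
  rwa [f.symm_apply_apply, f.symm_apply_apply, φ.proj_sec hm₁, φ.proj_sec hm₂] at this

end Plaques

/-! ### Existence of good coverings -/

section GoodCovering

/-- The homeomorphism `v ↦ r⁻¹ (v - c)` of a normed space. -/
def rescaleHomeomorph {E : Type*} [NormedAddCommGroup E] [NormedSpace ℝ E] (c : E) {r : ℝ}
    (hr : 0 < r) : E ≃ₜ E where
  toFun v := r⁻¹ • (v - c)
  invFun u := c + r • u
  left_inv v := by simp [smul_smul, hr.ne']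
  right_inv u := by simp [smul_smul, hr.ne']
  continuous_toFun := by fun_prop
  continuous_invFun := by fun_prop

lemma openCube_one_eq_ball (n : ℕ) : openCube n 1 = Metric.ball 0 1 := by
  rw [ball_pi _ one_pos]
  simp [openCube, openBox, Real.ball_eq_Ioo]

lemma mem_openBox_rescale {n : ℕ} {a b c u : Fin n → ℝ} {r : ℝ} (hr : 0 < r) :
    c + r • u ∈ openBox a b ↔
      u ∈ openBox (fun i => (a i - c i) / r) (fun i => (b i - c i) / r) := by
  simp only [openBox, mem_univ_pi, mem_Ioo, Pi.add_apply, Pi.smul_apply, smul_eq_mul,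
    div_lt_iff₀ hr, lt_div_iff₀ hr]
  refine forall_congr' fun i => ⟨fun h => ⟨?_, ?_⟩, fun h => ⟨?_, ?_⟩⟩ <;> linarith [h.1, h.2]

variable {p q : ℕ} {M : Type*} [TopologicalSpace M]
  [ChartedSpace (EuclideanSpace ℝ (Fin (p + q))) M]
  {φ : OpenPartialHomeomorph M ((Fin p → ℝ) × (Fin q → ℝ))} {F : C1Foliation p q M}

lemma C1Foliation.isChart_of_mem (hφ : φ ∈ F.charts) : F.IsChart φ :=
  ⟨F.isBoxChart φ hφ, fun ψ hψ => ⟨F.compatible φ hφ ψ hψ, F.compatible ψ hψ φ hφ⟩⟩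

lemma C1Foliation.IsChart.rescale (h : F.IsChart φ) (c : (Fin p → ℝ) × (Fin q → ℝ)) {r : ℝ}
    (hr : 0 < r) : F.IsChart (φ.transHomeomorph (rescaleHomeomorph c hr)) := by
  have hinj : ∀ v v' : (Fin p → ℝ) × (Fin q → ℝ),
      (rescaleHomeomorph c hr v).2 = (rescaleHomeomorph c hr v').2 ↔ v.2 = v'.2 := fun v v' => by
    simp [rescaleHomeomorph, hr.ne']
  refine ⟨⟨?_, ?_, ?_⟩, fun ψ hψ => ⟨?_, ?_⟩⟩
  · obtain ⟨a, b, a', b', hab⟩ := h.1.target_eq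
    refine ⟨fun i => (a i - c.1 i) / r, fun i => (b i - c.1 i) / r,
      fun i => (a' i - c.2 i) / r, fun i => (b' i - c.2 i) / r, ?_⟩
    ext u
    rw [φ.transHomeomorph_target, mem_preimage, hab, mem_prod, mem_prod]
    exact and_congr (mem_openBox_rescale hr) (mem_openBox_rescale hr)
  · have he : ContDiff ℝ 1 (rescaleHomeomorph c hr) := by
      change ContDiff ℝ 1 fun v => r⁻¹ • (v - c)
      fun_prop
    exact he.contMDiff.comp_contMDiffOn h.1.contMDiffOn
  · have he : ContDiff ℝ 1 (rescaleHomeomorph c hr).symm := by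
      change ContDiff ℝ 1 fun u => c + r • u
      fun_prop
    exact h.1.contMDiffOn_symm.comp he.contMDiff.contMDiffOn fun u hu => hu
  · intro x hx
    obtain ⟨U, hU, hUc⟩ := (h.2 ψ hψ).1 x hx
    exact ⟨U, hU, fun y hy z hz hyz => hUc y hy z hz ((hinj _ _).1 hyz)⟩
  · intro x hx
    obtain ⟨U, hU, hUc⟩ := (h.2 ψ hψ).2 x hx
    exact ⟨U, hU, fun y hy z hz hyz => (hinj _ _).2 (hUc y hy z hz hyz)⟩

lemma C1Foliation.IsChart.restr_target (h : F.IsChart φ) {s : Set ((Fin p → ℝ) × (Fin q → ℝ))}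
    (hs : IsOpen s) (hsub : s ⊆ φ.target)
    (hbox : ∃ (a b : Fin p → ℝ) (a' b' : Fin q → ℝ), s = openBox a b ×ˢ openBox a' b') :
    F.IsChart (φ.symm.restrOpen s hs).symm := by
  have htarget : (φ.symm.restrOpen s hs).symm.target = s := inter_eq_right.2 hsub
  have hsource : (φ.symm.restrOpen s hs).symm.source ⊆ φ.source := fun x hx => hx.1
  refine ⟨⟨?_, ?_, ?_⟩, fun ψ hψ => ⟨?_, ?_⟩⟩
  · rwa [htarget]
  · exact h.1.contMDiffOn.mono hsource
  · exact h.1.contMDiffOn_symm.mono (by rwa [htarget])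
  · exact fun x hx => (h.2 ψ hψ).1 x ⟨hsource hx.1, hx.2⟩
  · exact fun x hx => (h.2 ψ hψ).2 x ⟨hx.1, hsource hx.2⟩

/-- Each neighbourhood of a point contains the compact closure of the domain of a chart onto the
unit cube that extends to a neighbourhood of this closure. -/
lemma C1Foliation.exists_small_chart [T2Space M] (F : C1Foliation p q M) {O : Set M} (hO : IsOpen O)
    {x : M} (hx : x ∈ O) :
    ∃ V ψ : OpenPartialHomeomorph M ((Fin p → ℝ) × (Fin q → ℝ)), F.IsChart V ∧
      V.target = openCube p 1 ×ˢ openCube q 1 ∧ x ∈ V.source ∧ IsCompact (closure V.source) ∧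
      F.IsChart ψ ∧ closure V.source ⊆ ψ.source ∧ EqOn V ψ V.source ∧ closure V.source ⊆ O := by
  obtain ⟨φ, hφ, hxφ⟩ := F.cover x
  have hev : ∀ᶠ v in 𝓝 (φ x), v ∈ φ.target ∧ φ.symm v ∈ O := by
    refine (φ.open_target.eventually_mem (φ.map_source hxφ)).and ?_
    refine (φ.continuousAt_symm (φ.map_source hxφ)).eventually_mem ?_
    rw [φ.left_inv hxφ]
    exact hO.mem_nhds hx
  obtain ⟨r, hr, hrO⟩ := Metric.nhds_basis_closedBall.mem_iff.1 hev
  let ψ := φ.transHomeomorph (rescaleHomeomorph (φ x) hr)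
  have hψ : F.IsChart ψ := (F.isChart_of_mem hφ).rescale (φ x) hr
  have hball : ∀ u ∈ Metric.closedBall (0 : (Fin p → ℝ) × (Fin q → ℝ)) 1,
      u ∈ ψ.target ∧ ψ.symm u ∈ O := by
    intro u hu
    refine hrO (?_ : φ x + r • u ∈ _)
    rw [mem_closedBall_zero_iff] at hu
    rw [Metric.mem_closedBall, dist_eq_norm, add_sub_cancel_left, norm_smul,
      Real.norm_of_nonneg hr.le]
    exact mul_le_of_le_one_right hr.le hu
  have hcube : openCube p 1 ×ˢ openCube q 1 =
      Metric.ball (0 : (Fin p → ℝ) × (Fin q → ℝ)) 1 := by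
    rw [openCube_one_eq_ball, openCube_one_eq_ball, ball_prod_same]; rfl
  have hopen : IsOpen (openCube p 1 ×ˢ openCube q 1) :=
    (isOpen_openCube p 1).prod (isOpen_openCube q 1)
  have hsub : openCube p 1 ×ˢ openCube q 1 ⊆ ψ.target := fun u hu =>
    (hball u (Metric.ball_subset_closedBall (hcube ▸ hu))).1
  let K : Set M := ψ.symm '' Metric.closedBall 0 1
  have hK : IsCompact K := (isCompact_closedBall _ _).image_of_continuousOn
    (ψ.continuousOn_symm.mono fun u hu => (hball u hu).1)
  let V := (ψ.symm.restrOpen _ hopen).symm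
  have hVK : closure V.source ⊆ K := by
    refine closure_minimal (fun y hy => ?_) hK.isClosed
    refine ⟨ψ y, Metric.ball_subset_closedBall ?_, ψ.left_inv hy.1⟩
    rw [← hcube]
    exact hy.2
  refine ⟨V, ψ, hψ.restr_target hopen hsub ⟨_, _, _, _, rfl⟩, inter_eq_right.2 hsub,
    ⟨hxφ, ?_⟩, hK.of_isClosed_subset isClosed_closure hVK, hψ, ?_, fun y _ => rfl, ?_⟩
  · change r⁻¹ • (φ x - φ x) ∈ openCube p 1 ×ˢ openCube q 1
    rw [sub_self, smul_zero, hcube]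
    exact Metric.mem_ball_self one_pos
  · refine hVK.trans ?_
    rintro _ ⟨u, hu, rfl⟩
    exact ψ.map_target (hball u hu).1
  · refine hVK.trans ?_
    rintro _ ⟨u, hu, rfl⟩
    exact (hball u hu).2

/-- A compact set has a good covering, by charts that are small compared with a Lebesgue number of
the foliated atlas. -/
lemma C1Foliation.exists_isGoodCovering [T2Space M] [SecondCountableTopology M]
    (F : C1Foliation p q M) {Z : Set M} (hZ : IsCompact Z) :
    ∃ (k : ℕ) (V : Fin k → OpenPartialHomeomorph M ((Fin p → ℝ) × (Fin q → ℝ))),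
      F.IsGoodCovering Z V := by
  have : LocallyCompactSpace M :=
    ChartedSpace.locallyCompactSpace (EuclideanSpace ℝ (Fin (p + q))) M
  let _ : MetricSpace M := TopologicalSpace.metrizableSpaceMetric M
  obtain ⟨δ, hδ, hlebesgue⟩ := lebesgue_number_lemma_of_metric (s := Z)
    (c := fun ψ : F.charts => ψ.1.source) hZ
    (fun ψ => ψ.1.open_source) fun x _ => by
      obtain ⟨ψ, hψ, hx⟩ := F.cover x
      exact mem_iUnion.2 ⟨⟨ψ, hψ⟩, hx⟩
  have hδ' : 0 < δ / 3 := by positivity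
  choose V ψ hV htarget hmem hcomp hψ hclosure heq hball using fun x : M =>
    F.exists_small_chart (Metric.isOpen_ball (x := x) (ε := δ / 3)) (Metric.mem_ball_self hδ')
  obtain ⟨t, htZ, ht⟩ := hZ.elim_nhds_subcover (fun x => (V x).source)
    fun x _ => (V x).open_source.mem_nhds (hmem x)
  let c : Fin t.card → M := fun a => t.equivFin.symm a
  refine ⟨t.card, fun a => V (c a), fun a => hV _, fun a => htarget _, ?_,
    fun a => ⟨hcomp _, ψ _, hψ _, hclosure _, heq _⟩, ?_⟩
  · intro x hx
    obtain ⟨y, hy, hxy⟩ := mem_iUnion₂.1 (ht hx)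
    exact mem_iUnion.2 ⟨t.equivFin ⟨y, hy⟩, by simpa [c] using hxy⟩
  -- If two domains meet, both closures lie in the ball of radius `δ` around one of the centres.
  · rintro a b ⟨z, hza, hzb⟩
    obtain ⟨χ, hχ⟩ := hlebesgue (c a) (htZ _ (t.equivFin.symm a).2)
    refine ⟨χ, F.isChart_of_mem χ.2, union_subset ?_ ?_⟩
    · exact (hball _).trans ((Metric.ball_subset_ball (by linarith)).trans hχ)
    · refine fun y hy => hχ ?_
      have h1 := Metric.mem_ball.1 (hball _ hy)
      have h2 := Metric.mem_ball'.1 (hball _ (subset_closure hzb))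
      have h3 := Metric.mem_ball.1 (hball _ (subset_closure hza))
      rw [Metric.mem_ball]
      linarith [dist_triangle4 y (c b) z (c a)]

end GoodCovering

/-! ### Metrics on a compact space -/

section CompactMetric

open scoped NNReal

variable {X : Type*} [t : TopologicalSpace X]

/-- A metric on a compact space that is continuous defines the topology. -/
lemma MetricSpace.toTopologicalSpace_eq_of_eventually_lt [CompactSpace X] (d : MetricSpace X)
    (h : ∀ w, ∀ ε > 0, ∀ᶠ w' in 𝓝 w, d.dist w' w < ε) :
    d.toUniformSpace.toTopologicalSpace = t := by
  have hc : @Continuous X X t d.toUniformSpace.toTopologicalSpace id :=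
    (@Metric.continuous_iff' X X d.toPseudoMetricSpace t id).2 h
  -- Stated for all spaces, since `X` carries two topologies at this point.
  have hT2 : ∀ (Y : Type _) [MetricSpace Y], T2Space Y := fun _ _ => inferInstance
  have hinduced : ∀ {Y : Type _} [TopologicalSpace Y] [T2Space Y] {e : X → Y}, Continuous e →
      Function.Injective e → t = TopologicalSpace.induced e ‹_› := fun hc he =>
    (hc.isClosedEmbedding he).eq_induced
  have := @hinduced X d.toUniformSpace.toTopologicalSpace (@hT2 X d) id hc Function.injective_id
  exact (this.trans (@induced_id X d.toUniformSpace.toTopologicalSpace)).symm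

/-- Locally Lipschitz maps on a compact set are Lipschitz. -/
lemma IsCompact.exists_dist_le_of_lipDominates (d : MetricSpace X)
    (hd : d.toUniformSpace.toTopologicalSpace = t) {K : Set X} (hK : IsCompact K) {g : X → X}
    (hg : ∀ w ∈ K, @LipDominates X X X d.toPseudoMetricSpace.toPseudoEMetricSpace
      d.toPseudoMetricSpace.toPseudoEMetricSpace (𝓝 w) id g) :
    ∃ C : ℝ, 1 ≤ C ∧ ∀ w ∈ K, ∀ w' ∈ K, d.dist (g w) (g w') ≤ C * d.dist w w' := by
  subst hd
  have hloc : LocallyLipschitzOn K g := by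
    intro w hw
    obtain ⟨C, hC⟩ := hg w hw
    obtain ⟨s, hs, hsC⟩ := Filter.mem_prod_self_iff.1 hC
    exact ⟨C, s, mem_nhdsWithin_of_mem_nhds hs, fun x hx y hy => hsC (mk_mem_prod hx hy)⟩
  obtain ⟨C, hC⟩ := hloc.exists_lipschitzOnWith_of_compact hK
  refine ⟨max 1 C, le_max_left _ _, fun w hw w' hw' => (hC.dist_le_mul w hw w' hw').trans ?_⟩
  exact mul_le_mul_of_nonneg_right (le_max_right _ _) dist_nonneg

/-- Distances of diameter at most one on the pieces of a clopen partition, at distance one from each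
other, form a metric. -/
lemma exists_metricSpace_of_pieces [CompactSpace X] {ι G : Type*} [PseudoEMetricSpace G]
    {idx : X → ι} (hidx : ∀ w, ∀ᶠ w' in 𝓝 w, idx w' = idx w) {κ : X → G} (hκ : Continuous κ)
    {D : X → X → ℝ≥0∞} (hself : ∀ w, D w w = 0)
    (hcomm : ∀ w w', idx w = idx w' → D w w' = D w' w)
    (htri : ∀ w w' w'', idx w = idx w' → idx w' = idx w'' → D w w'' ≤ D w w' + D w' w'')
    (hone : ∀ w w', idx w = idx w' → D w w' ≤ 1)
    (hzero : ∀ w w', idx w = idx w' → D w w' = 0 → w = w')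
    {C : ι → ℝ≥0} (hD : ∀ w w', idx w = idx w' → D w w' ≤ C (idx w') * edist (κ w) (κ w')) :
    ∃ d : MetricSpace X, d.toUniformSpace.toTopologicalSpace = t ∧
      (∀ w w', idx w = idx w' → ENNReal.ofReal (d.dist w w') = D w w') ∧
      ∀ w w', idx w ≠ idx w' → d.dist w w' = 1 := by
  classical
  have htop : ∀ w w', idx w = idx w' → D w w' ≠ ⊤ := fun w w' h =>
    ((hone w w' h).trans_lt ENNReal.one_lt_top).ne
  let ρ : X → X → ℝ := fun w w' => if idx w = idx w' then (D w w').toReal else 1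
  have ρ_same : ∀ {w w'}, idx w = idx w' → ρ w w' = (D w w').toReal := fun h => if_pos h
  have ρ_ne : ∀ {w w'}, idx w ≠ idx w' → ρ w w' = 1 := fun h => if_neg h
  have ρ_nonneg : ∀ w w', 0 ≤ ρ w w' := fun w w' => by
    by_cases h : idx w = idx w'
    · rw [ρ_same h]; exact ENNReal.toReal_nonneg
    · rw [ρ_ne h]; exact zero_le_one
  have ρ_le_one : ∀ w w', ρ w w' ≤ 1 := fun w w' => by
    by_cases h : idx w = idx w'
    · rw [ρ_same h]; exact ENNReal.toReal_le_of_le_ofReal zero_le_one (by simpa using hone w w' h)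
    · rw [ρ_ne h]
  let d : MetricSpace X :=
    { dist := ρ
      dist_self := fun w => by rw [ρ_same rfl, hself, ENNReal.toReal_zero]
      dist_comm := fun w w' => by
        by_cases h : idx w = idx w'
        · rw [ρ_same h, ρ_same h.symm, hcomm w w' h]
        · rw [ρ_ne h, ρ_ne (Ne.symm h)]
      dist_triangle := fun w w' w'' => by
        by_cases h : idx w = idx w'
        · by_cases h' : idx w' = idx w''
          · rw [ρ_same h, ρ_same h', ρ_same (h.trans h'),
              ← ENNReal.toReal_add (htop w w' h) (htop w' w'' h')]
            exact ENNReal.toReal_mono (ENNReal.add_ne_top.2 ⟨htop w w' h, htop w' w'' h'⟩)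
              (htri w w' w'' h h')
          · rw [ρ_ne h']
            linarith [ρ_le_one w w'', ρ_nonneg w w']
        · rw [ρ_ne h]
          linarith [ρ_le_one w w'', ρ_nonneg w' w'']
      eq_of_dist_eq_zero := fun {w w'} h0 => by
        by_cases h : idx w = idx w'
        · refine hzero w w' h (((ENNReal.toReal_eq_zero_iff _).1 ?_).resolve_right (htop w w' h))
          exact (ρ_same h).symm.trans h0
        · exact absurd ((ρ_ne h).symm.trans h0) one_ne_zero }
  refine ⟨d, d.toTopologicalSpace_eq_of_eventually_lt fun w ε hε => ?_, fun w w' h => ?_,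
    fun w w' h => ρ_ne h⟩
  · have hlim : Tendsto (fun w' => (C (idx w) : ℝ≥0∞) * edist (κ w') (κ w)) (𝓝 w) (𝓝 0) := by
      have h1 : Tendsto (fun w' => edist (κ w') (κ w)) (𝓝 w) (𝓝 0) :=
        tendsto_iff_edist_tendsto_0.1 (hκ.tendsto w)
      have := ENNReal.Tendsto.const_mul (a := (C (idx w) : ℝ≥0∞)) h1 (Or.inr ENNReal.coe_ne_top)
      rwa [mul_zero] at this
    filter_upwards [hidx w, hlim.eventually_lt_const (ENNReal.ofReal_pos.2 hε)] with w' hw' hlt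
    have h := (hD w' w hw').trans_lt hlt
    change ρ w' w < ε
    rw [ρ_same hw']
    exact (ENNReal.lt_ofReal_iff_toReal_lt (htop w' w hw')).1 h
  · change ENNReal.ofReal (ρ w w') = _
    rw [ρ_same h, ENNReal.ofReal_toReal (htop w w' h)]

end CompactMetric

/-! ### The metric on the transversal space -/

section PulledBackMetric

open scoped NNReal

variable {n ν p q : ℕ} {𝔐 X M : Type*} [TopologicalSpace 𝔐] [TopologicalSpace X]
  {S : MatchboxManifold n 𝔐 X}

lemma RegularCovering.compactSpace (R : RegularCovering S ν) : CompactSpace X :=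
  ⟨by rw [← R.iUnion_model]; exact isCompact_iUnion fun i => (R.chart i).isCompact_model⟩

lemma RegularCovering.eq_of_mem_model (R : RegularCovering S ν) {i j : Fin ν} {w : X}
    (hi : w ∈ (R.chart i).model) (hj : w ∈ (R.chart j).model) : i = j := by
  by_contra h
  exact (R.disjoint_model h).le_bot ⟨hi, hj⟩

variable [TopologicalSpace M] [ChartedSpace (EuclideanSpace ℝ (Fin (p + q))) M]

/-- The transversal space has finite clopen partitions whose members are mapped into the domains of
the charts `V`, on which the transverse coordinate is injective and varies as little as desired. -/
lemma RegularCovering.exists_adapted_partition [T2Space X] [TotallyDisconnectedSpace X]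
    (R : RegularCovering S ν) {F : C1Foliation p q M} {Z : Set M} (hZ : F.IsSaturated Z)
    (f : 𝔐 ≃ₜ Z) {k : ℕ} {V : Fin k → OpenPartialHomeomorph M ((Fin p → ℝ) × (Fin q → ℝ))}
    (hV : ∀ α, F.IsChart (V α)) (hcover : Z ⊆ ⋃ α, (V α).source) (C : Fin k → ℝ≥0) :
    ∃ (m : ℕ) (W : Fin m → Set X) (i : Fin m → Fin ν) (α : Fin m → Fin k),
      (∀ a, IsClopen (W a)) ∧ (Pairwise fun a b => Disjoint (W a) (W b)) ∧ ⋃ a, W a = univ ∧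
      (∀ a, W a ⊆ (R.chart (i a)).model) ∧
      (∀ a, ∀ w ∈ W a, (f ((R.chart (i a)).sec w) : M) ∈ (V (α a)).source) ∧
      (∀ a, InjOn (fun w => (V (α a) (f ((R.chart (i a)).sec w))).2) (W a)) ∧
      ∀ a, ∀ w ∈ W a, ∀ w' ∈ W a, C (α a) * edist (V (α a) (f ((R.chart (i a)).sec w))).2
        (V (α a) (f ((R.chart (i a)).sec w'))).2 ≤ 1 := by
  have := R.compactSpace
  have hloc : ∀ w : X, ∃ (i : Fin ν) (α : Fin k) (U : TopologicalSpace.Opens X), w ∈ U ∧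
      (U : Set X) ⊆ (R.chart i).model ∧
      (∀ w ∈ U, (f ((R.chart i).sec w) : M) ∈ (V α).source) ∧
      InjOn (fun w => (V α (f ((R.chart i).sec w))).2) U ∧
      ∀ w ∈ U, ∀ w' ∈ U, C α * edist (V α (f ((R.chart i).sec w))).2
        (V α (f ((R.chart i).sec w'))).2 ≤ 1 := by
    intro w
    obtain ⟨i, hi⟩ := mem_iUnion.1 (R.iUnion_model ▸ mem_univ w : w ∈ ⋃ i, (R.chart i).model)
    obtain ⟨α, hα⟩ := mem_iUnion.1 (hcover (f ((R.chart i).sec w)).2)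
    obtain ⟨N, hN, hinj⟩ := (R.chart i).exists_nhds_injOn_transverse f hZ (hV α) hi hα
    have hsec : ContinuousAt (fun w' => (f ((R.chart i).sec w') : M)) w :=
      (continuous_subtype_val.comp f.continuous).continuousAt.comp ((R.chart i).continuousAt_sec hi)
    have hκ : ContinuousAt (fun w' => (V α (f ((R.chart i).sec w'))).2) w :=
      continuous_snd.continuousAt.comp
        (ContinuousAt.comp (g := V α) ((V α).continuousAt hα) hsec)
    have hsmall : ∀ᶠ P in 𝓝 w ×ˢ 𝓝 w, C α * edist (V α (f ((R.chart i).sec P.1))).2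
        (V α (f ((R.chart i).sec P.2))).2 < 1 := by
      have h1 : Tendsto (fun P : X × X => edist (V α (f ((R.chart i).sec P.1))).2
          (V α (f ((R.chart i).sec P.2))).2) (𝓝 w ×ˢ 𝓝 w) (𝓝 0) := by
        have h2 := Tendsto.edist (hκ.tendsto.comp (tendsto_fst (f := 𝓝 w) (g := 𝓝 w)))
          (hκ.tendsto.comp (tendsto_snd (f := 𝓝 w) (g := 𝓝 w)))
        rwa [edist_self] at h2
      have h2 := ENNReal.Tendsto.const_mul (a := (C α : ℝ≥0∞)) h1 (Or.inr ENNReal.coe_ne_top)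
      rw [mul_zero] at h2
      exact h2.eventually_lt_const one_pos
    obtain ⟨s, hs, hsP⟩ := mem_prod_self_iff.1 hsmall
    have hall : ∀ᶠ w' in 𝓝 w, w' ∈ (R.chart i).model ∧
        (f ((R.chart i).sec w') : M) ∈ (V α).source ∧ w' ∈ N ∧ w' ∈ s :=
      ((R.chart i).isClopen_model.isOpen.eventually_mem hi).and
        ((hsec.eventually_mem ((V α).open_source.mem_nhds hα)).and (Filter.Eventually.and hN hs))
    obtain ⟨U, hU, hUo, hwU⟩ := eventually_nhds_iff.1 hall
    refine ⟨i, α, ⟨U, hUo⟩, hwU, fun w' h => (hU w' h).1, fun w' h => (hU w' h).2.1,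
      hinj.mono fun w' h => (hU w' h).2.2.1, fun w' h w'' h' => ?_⟩
    have h1 : (w', w'') ∈ s ×ˢ s := ⟨(hU w' h).2.2.2, (hU w'' h').2.2.2⟩
    have h2 := hsP h1
    exact le_of_lt h2
  choose i α U hmem hmodel hsource hinj hsmall using hloc
  have hcov : TopologicalSpace.IsOpenCover U :=
    .of_sets (fun w => (U w).isOpen) (iUnion_eq_univ_iff.2 fun w => ⟨w, hmem w⟩)
  obtain ⟨m, W, hW, hWu, hWd⟩ := hcov.exists_finite_nonempty_disjoint_clopen_cover
  choose _ c hc using hW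
  refine ⟨m, fun a => W a, fun a => i (c a), fun a => α (c a), fun a => (W a).isClopen, ?_,
    univ_subset_iff.1 hWu, fun a => (hc a).trans (hmodel _), fun a w hw => hsource _ w (hc a hw),
    fun a => (hinj _).mono (hc a), fun a w hw w' hw' => hsmall _ w (hc a hw) w' (hc a hw')⟩
  exact fun a b hab => TopologicalSpace.Clopens.coe_disjoint.2 (hWd hab)

/-- If the holonomy maps increase the distances at most by the factor `C`, then they are
bi-Lipschitz, since the inverse of a holonomy map is a holonomy map. -/
lemma RegularCovering.isBiLipschitzFor_holonomy (R : RegularCovering S ν) {d : X → X → ℝ} {C : ℝ}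
    (hC : 1 ≤ C) (h : ∀ i j, ∀ w ∈ R.overlapProj i j, ∀ w' ∈ R.overlapProj i j,
      d (R.holonomyFun i j w) (R.holonomyFun i j w') ≤ C * d w w') (i j : Fin ν) :
    IsBiLipschitzFor d C (R.holonomy i j) := by
  intro w hw w' hw'
  refine ⟨?_, h i j w hw w' hw'⟩
  rw [inv_mul_le_iff₀ (by linarith)]
  have := h j i _ ((R.holonomy i j).map_source hw) _ ((R.holonomy i j).map_source hw')
  have h1 : R.holonomyFun j i (R.holonomy i j w) = w := (R.holonomy i j).left_inv hw
  have h2 : R.holonomyFun j i (R.holonomy i j w') = w' := (R.holonomy i j).left_inv hw'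
  rwa [h1, h2] at this

lemma RegularCovering.isLipschitzPseudogroup_holonomyPseudogroup (R : RegularCovering S ν)
    {d : X → X → ℝ} {C : ℝ} (hC : 1 ≤ C) (h : ∀ i j, IsBiLipschitzFor d C (R.holonomy i j)) :
    IsLipschitzPseudogroup d R.holonomyPseudogroup := by
  classical
  let P := {ij : Fin ν × Fin ν // (R.overlap ij.1 ij.2).Nonempty}
  let e := (Fintype.equivFin P).symm
  refine ⟨Fintype.card P, fun a => R.holonomy (e a).1.1 (e a).1.2, C, hC,
    fun a => ⟨R.isClopen_overlap _ _, R.isClopen_overlap _ _⟩, ?_, fun a => h _ _⟩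
  rw [RegularCovering.holonomyPseudogroup]
  congr 1
  ext g
  constructor
  · rintro ⟨a, rfl⟩
    exact ⟨_, _, (e a).2, rfl⟩
  · rintro ⟨i, j, hij, rfl⟩
    exact ⟨e.symm ⟨(i, j), hij⟩, by simp⟩

variable [RiemannianBundle (fun x : M => TangentSpace (𝓡 (p + q)) x)]

/-- If the path-length distances on the transversals are comparable with the transverse coordinates,
then they pull back to a metric that defines the topology of the transversal space, and the holonomy
maps are uniformly bi-Lipschitz for it. -/
lemma RegularCovering.exists_metricSpace_isPulledBackFrom [T2Space X] [TotallyDisconnectedSpace X]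
    (R : RegularCovering S ν) {F : C1Foliation p q M} {Z : Set M} (hZ : F.IsSaturated Z)
    (hdisc : ∀ ψ ∈ F.charts, IsTotallyDisconnected ((fun x => (ψ x).2) '' (Z ∩ ψ.source)))
    (f : 𝔐 ≃ₜ Z) {k : ℕ} {V : Fin k → OpenPartialHomeomorph M ((Fin p → ℝ) × (Fin q → ℝ))}
    (hV : F.IsGoodCovering Z V) {C : Fin k → ℝ≥0}
    (hC : ∀ α, ∀ u ∈ openCube q 1, ∀ v ∈ openCube q 1,
      edist u v ≤ C α * pathEDistIn (p := p) (q := q) (transversal (V α)) ((V α).symm (0, u))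
        ((V α).symm (0, v)) ∧
      pathEDistIn (p := p) (q := q) (transversal (V α)) ((V α).symm (0, u)) ((V α).symm (0, v)) ≤
        C α * edist u v) :
    ∃ d : MetricSpace X, d.toUniformSpace.toTopologicalSpace = ‹TopologicalSpace X› ∧
      IsPulledBackFrom R (fun x => (f x : M)) V d.dist ∧
      ∃ C : ℝ, 1 ≤ C ∧ ∀ i j, IsBiLipschitzFor d.dist C (R.holonomy i j) := by
  have := R.compactSpace
  obtain ⟨m, W, i, α, hW, hWd, hWu, hmodel, hsource, hinj, hsmall⟩ :=
    R.exists_adapted_partition hZ f hV.isChart hV.cover C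
  have hf : Continuous fun z => (f z : M) := continuous_subtype_val.comp f.continuous
  have hmem : ∀ w, ∃ a, w ∈ W a := fun w => mem_iUnion.1 (hWu ▸ mem_univ w)
  choose idx hidx using hmem
  have idx_eq : ∀ {w a}, w ∈ W a → idx w = a := fun {w a} h => by
    by_contra hne
    exact (hWd hne).le_bot ⟨hidx w, h⟩
  have idx_ev : ∀ w, ∀ᶠ w' in 𝓝 w, idx w' = idx w := fun w => by
    filter_upwards [(hW (idx w)).isOpen.mem_nhds (hidx w)] with w' hw' using idx_eq hw'
  -- the transverse coordinate on each member of the partition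
  let c : Fin m → X → (Fin q → ℝ) := fun a w => (V (α a) (f ((R.chart (i a)).sec w))).2
  let κ : X → (Fin q → ℝ) := fun w => c (idx w) w
  have hc : ∀ a, ∀ w ∈ W a, c a w ∈ openCube q 1 := fun a w hw => by
    have h1 := (V (α a)).map_source (hsource a w hw)
    rw [hV.target_eq] at h1
    exact h1.2
  have hcc : ∀ a, ∀ w ∈ W a, ContinuousAt (c a) w := fun a w hw => by
    have h1 : ContinuousAt (fun w' => (f ((R.chart (i a)).sec w') : M)) w :=
      hf.continuousAt.comp ((R.chart (i a)).continuousAt_sec (hmodel a hw))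
    exact continuous_snd.continuousAt.comp
      (ContinuousAt.comp (g := V (α a)) ((V (α a)).continuousAt (hsource a w hw)) h1)
  have hκ : Continuous κ := continuous_iff_continuousAt.2 fun w => by
    refine (hcc (idx w) w (hidx w)).congr ?_
    filter_upwards [idx_ev w] with w' hw'
    simp only [κ, hw']
  let D : Fin m → X → X → ℝ≥0∞ := fun a w w' =>
    pathEDistIn (p := p) (q := q) (transversal (V (α a)))
      (transversalProj (V (α a)) (f ((R.chart (i a)).sec w)))
      (transversalProj (V (α a)) (f ((R.chart (i a)).sec w')))
  have hDC : ∀ a, ∀ w ∈ W a, ∀ w' ∈ W a, edist (c a w) (c a w') ≤ C (α a) * D a w w' ∧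
      D a w w' ≤ C (α a) * edist (c a w) (c a w') := fun a w hw w' hw' =>
    hC (α a) _ (hc a w hw) _ (hc a w' hw')
  have hidx' : ∀ {w w'}, idx w = idx w' → w' ∈ W (idx w) := fun {w w'} h => h ▸ hidx w'
  obtain ⟨d, hd, hdD, hd1⟩ := exists_metricSpace_of_pieces (D := fun w w' => D (idx w) w w')
    (C := fun a => C (α a)) idx_ev hκ (fun w => pathEDistIn_self ⟨(0, c _ w), ⟨rfl, hc _ w (hidx w)⟩, rfl⟩)
    (fun w w' h => by rw [← h]; exact pathEDistIn_comm)
    (fun w w' w'' h h' => by rw [← h]; exact pathEDistIn_triangle)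
    (fun w w' h => (hDC _ w (hidx w) w' (hidx' h)).2.trans
      (hsmall _ w (hidx w) w' (hidx' h)))
    (fun w w' h h0 => by
      refine hinj (idx w) (hidx w) (hidx' h) (edist_le_zero.1 ?_)
      have := (hDC _ w (hidx w) w' (hidx' h)).1
      rwa [h0, mul_zero] at this)
    (fun w w' h => by
      have := (hDC _ w (hidx w) w' (hidx' h)).2
      simp only [κ, ← h]
      exact this)
  have hdW : ∀ a, ∀ w ∈ W a, ∀ w' ∈ W a, ENNReal.ofReal (d.dist w w') = D a w w' := by
    intro a w hw w' hw'
    rw [hdD w w' ((idx_eq hw).trans (idx_eq hw').symm), idx_eq hw]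
  refine ⟨d, hd, ⟨m, W, i, α, hW, hWd, hWu, hmodel, hsource, hdW, fun a b hab w hw w' hw' =>
    hd1 w w' (by rwa [idx_eq hw, idx_eq hw'])⟩, ?_⟩
  have hlip : ∀ ij : Fin ν × Fin ν, ∃ C : ℝ, 1 ≤ C ∧ ∀ w ∈ R.overlapProj ij.1 ij.2,
      ∀ w' ∈ R.overlapProj ij.1 ij.2,
        d.dist (R.holonomyFun ij.1 ij.2 w) (R.holonomyFun ij.1 ij.2 w') ≤ C * d.dist w w' := by
    rintro ⟨i₁, i₂⟩
    refine IsCompact.exists_dist_le_of_lipDominates d hd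
      (R.isClopen_overlap i₁ i₂).isClosed.isCompact fun w hw => ?_
    have hcont : ContinuousAt (R.holonomyFun i₁ i₂) w :=
      (R.continuousOn_holonomyFun i₁ i₂).continuousAt ((R.isOpen_overlapProj i₁ i₂).mem_nhds hw)
    obtain ⟨a, ha⟩ : ∃ a, w ∈ W a := ⟨_, hidx w⟩
    obtain ⟨b, hb⟩ : ∃ b, R.holonomyFun i₁ i₂ w ∈ W b := ⟨_, hidx _⟩
    -- The models are disjoint, so the members of the partition belong to the charts `i₁` and `i₂`.
    have hia : i a = i₁ := by
      obtain ⟨z, hz, rfl⟩ := hw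
      exact R.eq_of_mem_model (hmodel a ha) ((R.chart i₁).proj_mem_model hz.1)
    have hib : i b = i₂ := by
      obtain ⟨z, hz, rfl⟩ := hw
      rw [R.holonomyFun_proj i₁ i₂ hz] at hb
      exact R.eq_of_mem_model (hmodel b hb) ((R.chart i₂).proj_mem_model hz.2)
    subst hia hib
    obtain ⟨K, hK⟩ := R.lipDominates_holonomyFun hf (fun z => (f z).2) hdisc (i a) (i b) hw
      (hV.isChart (α a)) (hV.isChart (α b)) (hsource a w ha) (hsource b _ hb)
    have hev : ∀ᶠ w' in 𝓝 w, w' ∈ W a ∧ R.holonomyFun (i a) (i b) w' ∈ W b :=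
      ((hW a).isOpen.eventually_mem ha).and
        (hcont.eventually_mem ((hW b).isOpen.mem_nhds hb))
    refine ⟨C (α b) * (K * C (α a)), ?_⟩
    filter_upwards [hK, hev.prod_mk hev] with P hP hPW
    have hda := hdW a P.1 hPW.1.1 P.2 hPW.2.1
    have hdb := hdW b _ hPW.1.2 _ hPW.2.2
    have hedist : ∀ x y, @edist X d.toPseudoMetricSpace.toPseudoEMetricSpace.toEDist x y =
        ENNReal.ofReal (d.dist x y) := fun x y => @edist_dist X d.toPseudoMetricSpace x y
    rw [hedist, hedist, hdb, id, id, hda, ENNReal.coe_mul, ENNReal.coe_mul, mul_assoc, mul_assoc]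
    refine (hDC b _ hPW.1.2 _ hPW.2.2).2.trans (mul_le_mul_right (hP.trans ?_) _)
    exact mul_le_mul_right (hDC a _ hPW.1.1 _ hPW.2.1).1 _
  choose L hL1 hL using hlip
  obtain ⟨B, hB⟩ := (finite_range L).bddAbove
  refine ⟨max 1 B, le_max_left _ _,
    R.isBiLipschitzFor_holonomy (le_max_left _ _) fun i₁ i₂ w hw w' hw' => ?_⟩
  refine (hL (i₁, i₂) w hw w' hw').trans (mul_le_mul_of_nonneg_right ?_ ?_)
  · exact (hB (mem_range_self _)).trans (le_max_right _ _)
  · exact @dist_nonneg X d.toPseudoMetricSpace w w'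

end PulledBackMetric

end

theorem mainTheorem3
    {n ν p q : ℕ} {𝔐 X M : Type*}
    -- a minimal matchbox manifold with a regular covering
    [TopologicalSpace 𝔐] [CompactSpace 𝔐] [TopologicalSpace.MetrizableSpace 𝔐] [ConnectedSpace 𝔐]
    [TopologicalSpace X] [TopologicalSpace.SeparableSpace X] [TopologicalSpace.MetrizableSpace X]
    [TotallyDisconnectedSpace X]
    (S : MatchboxManifold n 𝔐 X) (hS : S.IsMinimal) (R : RegularCovering S ν)
    -- a smooth Riemannian manifold with a foliation of class C¹
    [TopologicalSpace M] [T2Space M] [SecondCountableTopology M]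
    [ChartedSpace (EuclideanSpace ℝ (Fin (p + q))) M] [IsManifold (𝓡 (p + q)) ∞ M]
    [RiemannianBundle (fun x : M => TangentSpace (𝓡 (p + q)) x)]
    [IsContMDiffRiemannianBundle (𝓡 (p + q)) ∞ (EuclideanSpace ℝ (Fin (p + q)))
      (fun x : M => TangentSpace (𝓡 (p + q)) x)]
    (F : C1Foliation p q M)
    -- an exceptional minimal set homeomorphic to the matchbox manifold
    (Z : Set M) (hZ : F.IsExceptionalMinimalSet Z) (f : 𝔐 ≃ₜ Z) :
    -- good coverings exist, and each of them gives a metric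
    (∃ (k : ℕ) (V : Fin k → OpenPartialHomeomorph M ((Fin p → ℝ) × (Fin q → ℝ))),
      F.IsGoodCovering Z V) ∧
    ∀ (k : ℕ) (V : Fin k → OpenPartialHomeomorph M ((Fin p → ℝ) × (Fin q → ℝ))),
      F.IsGoodCovering Z V →
      ∃ d : MetricSpace X,
        -- the metric defines the topology of the transversal space
        d.toUniformSpace.toTopologicalSpace = ‹TopologicalSpace X› ∧
        -- the metric is pulled back from the transversals of the good charts
        IsPulledBackFrom R (fun x => (f x : M)) V d.dist ∧
        -- the generators of the holonomy pseudogroup are uniformly bi-Lipschitz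
        (∃ C : ℝ, 1 ≤ C ∧ ∀ i j, IsBiLipschitzFor d.dist C (R.holonomy i j)) ∧
        -- the holonomy pseudogroup is Lipschitz
        IsLipschitzPseudogroup d.dist R.holonomyPseudogroup := by
  have : CompactSpace Z := f.compactSpace
  have hZc : IsCompact Z := isCompact_iff_compactSpace.2 this
  have : IsContinuousRiemannianBundle (EuclideanSpace ℝ (Fin (p + q)))
      (fun x : M => TangentSpace (𝓡 (p + q)) x) :=
    IsContMDiffRiemannianBundle.isContinuousRiemannianBundle_tangentSpace (n := ∞) ‹_›
  refine ⟨F.exists_isGoodCovering hZc, fun k V hV => ?_⟩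
  choose hc ψ hψ hsub heq using hV.extension
  choose C hC using fun α =>
    exists_pathEDistIn_transversal_comparison (hV.target_eq α) (hc α) (hψ α).1 (hsub α) (heq α)
  obtain ⟨d, hd, hpull, B, hB1, hB⟩ := R.exists_metricSpace_isPulledBackFrom hZ.isSaturated
    hZ.isTotallyDisconnected f hV hC
  exact ⟨d, hd, hpull, ⟨B, hB1, hB⟩, R.isLipschitzPseudogroup_holonomyPseudogroup hB1 hB⟩
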